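/- Let $C,n,K\ge 1$ be integers with $K\mid n$, let $\alpha\in(0,1)$, let $\mathcal X$ be a measurable space and $\mathcal Y=\{1,\dots,C\}$. **Scores.** Let $\pi=(\pi_y(x))_{y\in\mathcal Y}$ be a classifier with $\pi_y(x)\ge 0$ and $\sum_y\pi_y(x)=1$ for all $x$. List the labels by decreasing $\pi_y(x)$, breaking ties by a given order of the labels, and let $\pi_{(1)}(x)\ge\dots\ge\pi_{(C)}(x)$ be the sorted values. For $\tau\in[0,1]$ let $$L(x;\pi,\tau)=\min\Big\{c\in\{1,\dots,C\}:\sum_{j=1}^{c}\pi_{(j)}(x)\ge\tau\Big\},\qquad V(x;\pi,\tau)=\frac{1}{\pi_{(L)}(x)}\Big[\sum_{c=1}^{L}\pi_{(c)}(x)-\tau\Big]\ \text{ with } L=L(x;\pi,\tau).$$ For $u\in[0,1]$ let $\mathcal S(x,u;\pi,\tau)$ be the set of the first $L(x;\pi,\tau)-1$ labels in the list if $u\le V(x;\pi,\tau)$, and of the first $L(x;\pi,\tau)$ labels otherwise. The score is $$E(x,y,u;\pi)=\inf\{\tau\in[0,1]:y\in\mathcal S(x,u;\pi,\tau)\},$$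 where the infimum is taken in $[0,1]$, so that it is $1$ for the empty set. **Learning algorithm.** Let $\mathcal B$ map every finite sequence of elements of $\mathcal X\times\mathcal Y$ to a classifier as above, (jointly) measurably in the sequence and $x$. Assume that $\mathcal B$ is invariant to permutations of its input samples. **Data and algorithm.** Let $(X_1,Y_1),\dots,(X_{n+1},Y_{n+1})$ be exchangeable random variables in $\mathcal X\times\mathcal Y$. Split $\{1,\dots,n\}$ at random (uniformly or according to any other law) into $K$ disjoint folds $\mathcal I_1,\dots,\mathcal I_K$ of size $n/K$ each, and write $k(i)$ for the fold that contains $i$. Let $U_1,\dots,U_{n+1}$ be i.i.d. uniform on $(0,1)$, and let the orders of the labels that break the ties for the samples $1,\dots,n+1$ be i.i.d. of any law (for example, all equal to a fixed order, or uniformly random). The samples, the split, the $U_i$ and the tie-breaking orders are independent of each other. For each fold, train $\hat\pi^k=\mathcal B\big(((X_i,Y_i))_{i\in\{1,\dots,n\}\setminus\mathcal I_k}\big)$. The CV+ prediction set is $$\hat{\mathcal C}^{\mathrm{CV+}}_{n,\alpha}(X_{n+1})=\Big\{y\in\mathcal Y:\sum_{i=1}^n\mathbf 1\big[E(X_i,Y_i,U_i;\hat\pi^{k(i)})<E(X_{n+1},y,U_{n+1};\hat\pi^{k(i)})\big]<(1-\alpha)(n+1)\Big\},$$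 where the scores of sample $i$ and of sample $n+1$ use the tie-breaking orders of these samples. **Conclusion.** $$\mathbb P\big[Y_{n+1}\in\hat{\mathcal C}^{\mathrm{CV+}}_{n,\alpha}(X_{n+1})\big]\ \ge\ 1-2\alpha-\min\left\{\frac{2(1-1/K)}{n/K+1},\ \frac{1-K/n}{K+1}\right\}.$$ In the special case $K=n$ (jackknife+), $\mathbb P\big[Y_{n+1}\in\hat{\mathcal C}^{\mathrm{CV+}}_{n,\alpha}(X_{n+1})\big]\ge 1-2\alpha$. -/

import Mathlib

open MeasureTheory ProbabilityTheory

noncomputable section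

namespace CVPlus

/-- The discrete measurable structure on the finite set of permutations of the labels. -/
instance permMeasurableSpace (C : ℕ) : MeasurableSpace (Equiv.Perm (Fin C)) := ⊤

/-! ### Generalized quantiles and scores

Throughout this part, `p : Fin C → ℝ` is the vector of class probabilities `π_y(x)` at a given
feature value `x`, and `ρ` is a priority order of the labels that is used only to break ties
between equal probabilities. -/

/-- The label `y` comes before the label `z` when labels are listed by decreasing probability,
ties being broken according to `ρ`. -/
def Precedes {C : ℕ} (p : Fin C → ℝ) (ρ : Equiv.Perm (Fin C)) (y z : Fin C) : Prop :=
  p z < p y ∨ (p y = p z ∧ ρ y < ρ z)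

open Classical in
/-- The position of the label `y`, in `{1, …, C}`, in the list of labels by decreasing
probability. -/
def rank {C : ℕ} (p : Fin C → ℝ) (ρ : Equiv.Perm (Fin C)) (y : Fin C) : ℕ :=
  (Finset.univ.filter fun z => Precedes p ρ z y).card + 1

/-- The set of the labels of the `c` largest probabilities. -/
def topLabels {C : ℕ} (p : Fin C → ℝ) (ρ : Equiv.Perm (Fin C)) (c : ℕ) : Finset (Fin C) :=
  Finset.univ.filter fun y => rank p ρ y ≤ c

/-- The order statistic `π_(c)`: the probability of the one label in position `c`. -/
def orderStat {C : ℕ} (p : Fin C → ℝ) (ρ : Equiv.Perm (Fin C)) (c : ℕ) : ℝ :=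
  ∑ y ∈ Finset.univ.filter (fun y => rank p ρ y = c), p y

/-- `π_(1) + … + π_(c)`. -/
def cumProb {C : ℕ} (p : Fin C → ℝ) (ρ : Equiv.Perm (Fin C)) (c : ℕ) : ℝ :=
  ∑ j ∈ Finset.Icc 1 c, orderStat p ρ j

/-- The generalized conditional quantile
`L = min {c ∈ {1, …, C} : π_(1) + … + π_(c) ≥ τ}`. -/
def genQuantile {C : ℕ} (p : Fin C → ℝ) (ρ : Equiv.Perm (Fin C)) (τ : ℝ) : ℕ :=
  sInf {c : ℕ | c ∈ Finset.Icc 1 C ∧ τ ≤ cumProb p ρ c}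

/-- `V = (π_(1) + … + π_(L) - τ) / π_(L)`. -/
def genV {C : ℕ} (p : Fin C → ℝ) (ρ : Equiv.Perm (Fin C)) (τ : ℝ) : ℝ :=
  (cumProb p ρ (genQuantile p ρ τ) - τ) / orderStat p ρ (genQuantile p ρ τ)

/-- The randomized set `𝒮`: the labels of the `L - 1` largest probabilities if `u ≤ V`, and of
the `L` largest probabilities otherwise. -/
def genSet {C : ℕ} (p : Fin C → ℝ) (ρ : Equiv.Perm (Fin C)) (u τ : ℝ) : Finset (Fin C) :=
  if u ≤ genV p ρ τ then topLabels p ρ (genQuantile p ρ τ - 1)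
  else topLabels p ρ (genQuantile p ρ τ)

/-- The generalized inverse quantile conformity score `E`: the smallest `τ ∈ [0, 1]` for which
`y` belongs to `𝒮`. It is an infimum in the complete lattice `[0, 1]`, since the set of those `τ`
is an interval that need not contain its left end point; the infimum of the empty set (a label
of zero probability) is `1`. -/
def score {C : ℕ} (p : Fin C → ℝ) (ρ : Equiv.Perm (Fin C)) (y : Fin C) (u : ℝ) :
    unitInterval :=
  sInf {τ : unitInterval | y ∈ genSet p ρ u (τ : ℝ)}

/-! ### Learning algorithms -/

/-- A learning algorithm: it maps a finite sequence of labelled samples to a classifier, which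
gives every feature value `x` and every label `y` an estimated class probability. -/
abbrev Learner (𝒳 : Type*) (C : ℕ) : Type _ := List (𝒳 × Fin C) → 𝒳 → Fin C → ℝ

/-- The classifiers that are produced are standardized: the estimated class probabilities are
nonnegative and add up to one. -/
def Learner.Standardized {𝒳 : Type*} {C : ℕ} (B : Learner 𝒳 C) : Prop :=
  ∀ l x, B l x ∈ stdSimplex ℝ (Fin C)

/-- The output of the algorithm is invariant to permutations of its input samples. -/
def Learner.PermInvariant {𝒳 : Type*} {C : ℕ} (B : Learner 𝒳 C) : Prop :=
  ∀ l l' : List (𝒳 × Fin C), l.Perm l' → B l = B l'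

/-- For every size of the training sample, the estimated probabilities depend measurably on the
training sample and on the feature value, jointly. -/
def Learner.JointlyMeasurable {𝒳 : Type*} [MeasurableSpace 𝒳] {C : ℕ} (B : Learner 𝒳 C) :
    Prop :=
  ∀ (N : ℕ) (y : Fin C),
    Measurable fun q : (Fin N → 𝒳 × Fin C) × 𝒳 => B (List.ofFn q.1) q.2 y

/-! ### The CV+ prediction set -/

/-- `k : Fin n → Fin K` splits `n` samples into `K` folds of size `n / K` each; `k i` is the fold
that contains sample `i`. -/
def IsSplit {n K : ℕ} (k : Fin n → Fin K) : Prop :=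
  ∀ j : Fin K, (Finset.univ.filter fun i => k i = j).card = n / K

/-- The classifier `π̂^j`, trained on all samples except those in the fold `j`. -/
def foldClassifier {𝒳 : Type*} {C n K : ℕ} (B : Learner 𝒳 C) (z : Fin n → 𝒳 × Fin C)
    (k : Fin n → Fin K) (j : Fin K) : 𝒳 → Fin C → ℝ :=
  B (((List.finRange n).filter fun i => k i ≠ j).map z)

open Classical in
/-- The CV+ prediction set at level `α` and feature value `x`, computed from the labelled
samples `z i = (X_i, Y_i)`, the folds `k`, the uniform variables `u i` and tie-breaking orders
`ρ i` of the samples, and those, `u'` and `ρ'`, of the test point. -/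
def cvPlusSet {𝒳 : Type*} {C n K : ℕ} (B : Learner 𝒳 C) (α : ℝ) (z : Fin n → 𝒳 × Fin C)
    (k : Fin n → Fin K) (u : Fin n → ℝ) (ρ : Fin n → Equiv.Perm (Fin C))
    (x : 𝒳) (u' : ℝ) (ρ' : Equiv.Perm (Fin C)) : Set (Fin C) :=
  {y | (∑ i : Fin n,
      if score (foldClassifier B z k (k i) (z i).1) (ρ i) (z i).2 (u i)
        < score (foldClassifier B z k (k i) x) ρ' y u' then (1 : ℝ) else 0)
      < (1 - α) * ((n : ℝ) + 1)}

/-! ### Exchangeability -/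

/-- The random variables `Z i` are exchangeable: permuting them does not change their joint
law. -/
def Exchangeable {ι Ω 𝒵 : Type*} [MeasurableSpace Ω] [MeasurableSpace 𝒵]
    (Z : ι → Ω → 𝒵) (μ : Measure Ω) : Prop :=
  ∀ σ : Equiv.Perm ι, μ.map (fun ω i => Z (σ i) ω) = μ.map (fun ω i => Z i ω)

end CVPlus

end

noncomputable section

namespace CVPlus

/-! ### Counting permutations with prescribed images -/

/-! By exchangeability the data may be replaced by a uniformly random arrangement `σ` of `n + 1`
fixed points, so it suffices to bound, pointwise in the data and the split, the proportion of
arrangements that miscover (`card_miscovers_rearrange_le`). Let `t` be the test point, `F` one of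
the folds, and m = n / K. The classifier that compares `t` with the points of `F` is trained outside
of A = {t} ∪ F, so it depends on A alone: inside A there is one fixed ranking, in which all points
play the same role (`foldScore_rearrange`). Miscoverage says that at most ℓ = α(n + 1) - 1 points
score at least as high as `t`.

Let q(t) and w(t, F) be the conditional miscoverage probabilities given the test point, and given
the test point and a fold. Any two points of A are comparable, which bounds (∑ w)² - ∑ w² over t ∈ A
by twice a weighted loss (`sum_sq_sub_sum_sq_le`). Sum this over all A of size m + 1. The losses
contribute at most 2ℓ per unit of weight. Since w averages to q over all folds, and also over the
folds through any given point, replacing w by q can only decrease the sum of the (∑ w)²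
(`sum_mul_sum_of_star`), while ∑ w² exceeds ∑ q² by the variance of w around q. If that variance is
at most a constant c times its value for independent folds, then s = ∑ q satisfies s² - cs + (c - 1)
∑ q² ≤ 2ℓs, and Cauchy–Schwarz gives s / (n + 1) ≤ (2ℓ + c) / (n + c) (`sum_indicator_mul_le`).

By duality (`sum_sq_foldMean_sub_le`) the variance bound follows from a second moment bound for sums
∑ g(F_j) over the folds. Cauchy–Schwarz gives c = K. For c = m + 1, g is centred even on the folds
through a given point, so in the cross terms the indicator of disjointness may be replaced by the
kernel (|F ∩ F'| - 1)⁺, whose row sums are explicit (`sum_disjoint_mul_le`). The two values of c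
produce the two terms of the minimum. What remains is a closed form of the score (`coe_score`) and
the passage to the probability measure. -/

open scoped Nat in
lemma card_filter_comp_eq {α γ : Type*} [Fintype α] [DecidableEq α] [Fintype γ] [DecidableEq γ]
    (f g : α → γ)
    (h : ∀ c, (Finset.univ.filter fun a => f a = c).card
      = (Finset.univ.filter fun a => g a = c).card) :
    (Finset.univ.filter fun σ : Equiv.Perm α => f ∘ σ = g).card
      = ∏ c, ((Finset.univ.filter fun a => g a = c).card)! := by
  have e : ∀ c, Nonempty ({a // g a = c} ≃ {a // f a = c}) := fun c => by
    refine ⟨Fintype.equivOfCardEq ?_⟩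
    rw [Fintype.card_subtype, Fintype.card_subtype, h c]
  -- One solution `σ₀` of f ∘ σ = g; all the others form its left coset by the stabilizer of `g`,
  -- which has the required cardinality.
  let σ₀ : Equiv.Perm α := Equiv.ofFiberEquiv fun c => (e c).some
  have hσ₀ : f ∘ σ₀ = g := funext fun a => Equiv.ofFiberEquiv_map _ a
  have key := DomMulAct.stabilizer_card g
  simp only [Fintype.card_subtype] at key
  rw [← key]
  refine Finset.card_bij' (fun σ _ => σ₀⁻¹ * σ) (fun τ _ => σ₀ * τ) ?_ ?_ ?_ ?_
  · intro σ hσ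
    simp only [Finset.mem_filter, Finset.mem_univ, true_and] at hσ ⊢
    have hcancel : ⇑σ₀ ∘ ⇑(σ₀⁻¹ * σ) = σ := by funext a; simp
    rw [← hσ₀, Function.comp_assoc, hcancel, hσ, hσ₀]
  · intro τ hτ
    simp only [Finset.mem_filter, Finset.mem_univ, true_and] at hτ ⊢
    rw [← hτ, ← hσ₀]
    funext a
    simp
  · intro σ _; simp
  · intro σ _; simp

/-- The index of the first of three sets that contains a point, and `3` if there is none. -/
def color {α : Type*} [DecidableEq α] (P Q R : Finset α) (a : α) : Fin 4 :=
  if a ∈ P then 0 else if a ∈ Q then 1 else if a ∈ R then 2 else 3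

lemma card_filter_color {α : Type*} [Fintype α] [DecidableEq α] {P Q R : Finset α}
    (hPQ : Disjoint P Q) (hPR : Disjoint P R) (hQR : Disjoint Q R) (c : Fin 4) :
    (Finset.univ.filter fun a => color P Q R a = c).card
      = ![P.card, Q.card, R.card, Fintype.card α - (P.card + Q.card + R.card)] c := by
  have h0 : (Finset.univ.filter fun a => color P Q R a = 0) = P := by
    ext a; rw [Finset.mem_filter, color]; split_ifs <;> simp_all
  have h1 : (Finset.univ.filter fun a => color P Q R a = 1) = Q := by
    ext a
    have hPQa : a ∈ _ → a ∉ _ := fun h => Finset.disjoint_left.mp hPQ h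
    rw [Finset.mem_filter, color]; split_ifs <;> simp_all
  have h2 : (Finset.univ.filter fun a => color P Q R a = 2) = R := by
    ext a
    have hPRa : a ∈ _ → a ∉ _ := fun h => Finset.disjoint_left.mp hPR h
    have hQRa : a ∈ _ → a ∉ _ := fun h => Finset.disjoint_left.mp hQR h
    rw [Finset.mem_filter, color]; split_ifs <;> simp_all
  have h3 : (Finset.univ.filter fun a => color P Q R a = 3) = (P ∪ Q ∪ R)ᶜ := by
    ext a
    rw [Finset.mem_filter, color, Finset.mem_compl, Finset.mem_union, Finset.mem_union]
    split_ifs <;> simp_all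
  fin_cases c
  · simpa using congrArg Finset.card h0
  · simpa using congrArg Finset.card h1
  · simpa using congrArg Finset.card h2
  · have := congrArg Finset.card h3
    rw [Finset.card_compl, Finset.card_union_of_disjoint
      (Finset.disjoint_union_left.mpr ⟨hPR, hQR⟩), Finset.card_union_of_disjoint hPQ] at this
    simpa using this

open scoped Nat in
/-- The number of permutations that map three disjoint sets onto three disjoint sets. -/
lemma card_filter_image_eq {α : Type*} [Fintype α] [DecidableEq α] {P Q R P' Q' R' : Finset α}
    (hPQ : Disjoint P Q) (hPR : Disjoint P R) (hQR : Disjoint Q R)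
    (hPQ' : Disjoint P' Q') (hPR' : Disjoint P' R') (hQR' : Disjoint Q' R')
    (hP : P'.card = P.card) (hQ : Q'.card = Q.card) (hR : R'.card = R.card) :
    (Finset.univ.filter fun σ : Equiv.Perm α =>
        P.image σ = P' ∧ Q.image σ = Q' ∧ R.image σ = R').card
      = (P.card)! * (Q.card)! * (R.card)!
        * (Fintype.card α - (P.card + Q.card + R.card))! := by
  have h := card_filter_comp_eq (color P' Q' R') (color P Q R) (fun c => by
    rw [card_filter_color hPQ hPR hQR, card_filter_color hPQ' hPR' hQR', hP, hQ, hR])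
  simp only [card_filter_color hPQ hPR hQR, Fin.prod_univ_four] at h
  rw [show (P.card)! * (Q.card)! * (R.card)!
      * (Fintype.card α - (P.card + Q.card + R.card))! = _ from h.symm]
  congr 1
  ext σ
  simp only [Finset.mem_filter, Finset.mem_univ, true_and]
  constructor
  · rintro ⟨rfl, rfl, rfl⟩
    funext a
    simp [color]
  · intro hσ
    have hc : ∀ a, color P' Q' R' (σ a) = color P Q R a := fun a => congrFun hσ a
    have hmem : ∀ {A B C : Finset α}, Disjoint A B → Disjoint A C → Disjoint B C → ∀ a,
        (a ∈ A ↔ color A B C a = 0) ∧ (a ∈ B ↔ color A B C a = 1) ∧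
        (a ∈ C ↔ color A B C a = 2) := by
      intro A B C hAB hAC hBC a
      have hABa : a ∈ _ → a ∉ _ := fun h => Finset.disjoint_left.mp hAB h
      have hACa : a ∈ _ → a ∉ _ := fun h => Finset.disjoint_left.mp hAC h
      have hBCa : a ∈ _ → a ∉ _ := fun h => Finset.disjoint_left.mp hBC h
      simp only [color]; split_ifs <;> simp_all
    have himg : ∀ {A A' : Finset α}, (∀ a, σ a ∈ A' ↔ a ∈ A) → A.image σ = A' := by
      intro A A' hA
      ext b
      constructor
      · intro hb
        obtain ⟨a, ha, rfl⟩ := Finset.mem_image.mp hb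
        exact (hA a).mpr ha
      · intro hb
        exact Finset.mem_image.mpr ⟨σ.symm b, (hA _).mp (by simpa using hb), by simp⟩
    refine ⟨himg fun a => ?_, himg fun a => ?_, himg fun a => ?_⟩
    · rw [(hmem hPQ' hPR' hQR' (σ a)).1, (hmem hPQ hPR hQR a).1, hc]
    · rw [(hmem hPQ' hPR' hQR' (σ a)).2.1, (hmem hPQ hPR hQR a).2.1, hc]
    · rw [(hmem hPQ' hPR' hQR' (σ a)).2.2, (hmem hPQ hPR hQR a).2.2, hc]

/-! ### Random test point and folds -/

/-- The set of the points that the arrangement `σ` of `n + 1` points puts into the fold `j`. The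
last position, that of the test point, is in no fold. -/
def foldImage {n K : ℕ} (k : Fin n → Fin K) (σ : Equiv.Perm (Fin (n + 1))) (j : Fin K) :
    Finset (Fin (n + 1)) :=
  ((Finset.univ.filter fun i => k i = j).image Fin.castSucc).image σ

/-- The arrangements that make `t` the test point. -/
def withTest {n : ℕ} (t : Fin (n + 1)) : Finset (Equiv.Perm (Fin (n + 1))) :=
  Finset.univ.filter fun σ => σ (Fin.last n) = t

/-- The sets that can be a fold of size `m` when `t` is the test point. -/
def foldSets {n : ℕ} (m : ℕ) (t : Fin (n + 1)) : Finset (Finset (Fin (n + 1))) :=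
  (Finset.univ.erase t).powersetCard m

section Folds

variable {n K m : ℕ} {k : Fin n → Fin K}

lemma mem_withTest {t : Fin (n + 1)} {σ : Equiv.Perm (Fin (n + 1))} :
    σ ∈ withTest t ↔ σ (Fin.last n) = t := by
  simp [withTest]

lemma mem_foldSets {t : Fin (n + 1)} {F : Finset (Fin (n + 1))} :
    F ∈ foldSets m t ↔ t ∉ F ∧ F.card = m := by
  simp [foldSets, Finset.mem_powersetCard, Finset.subset_erase]

lemma card_foldSets (t : Fin (n + 1)) : (foldSets m t).card = n.choose m := by
  simp [foldSets, Finset.card_powersetCard]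

lemma mem_foldImage {σ : Equiv.Perm (Fin (n + 1))} {j : Fin K} {x : Fin (n + 1)} :
    x ∈ foldImage k σ j ↔ ∃ i, k i = j ∧ σ i.castSucc = x := by
  simp [foldImage]

lemma sum_foldImage (σ : Equiv.Perm (Fin (n + 1))) (j : Fin K) (f : Fin (n + 1) → ℝ) :
    ∑ x ∈ foldImage k σ j, f x = ∑ i with k i = j, f (σ i.castSucc) := by
  rw [foldImage, Finset.sum_image σ.injective.injOn,
    Finset.sum_image (Fin.castSucc_injective n).injOn]

lemma card_foldPos (hk : ∀ j, (Finset.univ.filter fun i => k i = j).card = m) (j : Fin K) :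
    ((Finset.univ.filter fun i => k i = j).image Fin.castSucc).card = m := by
  rw [Finset.card_image_of_injective _ (Fin.castSucc_injective n), hk]

lemma foldImage_mem_foldSets (hk : ∀ j, (Finset.univ.filter fun i => k i = j).card = m)
    {t : Fin (n + 1)} {σ : Equiv.Perm (Fin (n + 1))} (hσ : σ ∈ withTest t) (j : Fin K) :
    foldImage k σ j ∈ foldSets m t := by
  rw [mem_foldSets]
  constructor
  · rw [mem_foldImage]
    rintro ⟨i, -, hi⟩
    rw [← mem_withTest.mp hσ] at hi
    exact (Fin.castSucc_lt_last i).ne (σ.injective hi)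
  · rw [foldImage, Finset.card_image_of_injective _ σ.injective, card_foldPos hk]

lemma disjoint_foldPos {j j' : Fin K} (h : j ≠ j') :
    Disjoint ((Finset.univ.filter fun i => k i = j).image Fin.castSucc)
      ((Finset.univ.filter fun i => k i = j').image Fin.castSucc) := by
  rw [Finset.disjoint_image (Fin.castSucc_injective n)]
  exact Finset.disjoint_filter.mpr fun i _ h1 h2 => h (h1.symm.trans h2)

lemma disjoint_foldImage {j j' : Fin K} (h : j ≠ j') (σ : Equiv.Perm (Fin (n + 1))) :
    Disjoint (foldImage k σ j) (foldImage k σ j') :=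
  (Finset.disjoint_image σ.injective).mpr (disjoint_foldPos h)

/-- The folds partition the points other than the test point. -/
lemma sum_mem_foldImage {t x : Fin (n + 1)} {σ : Equiv.Perm (Fin (n + 1))}
    (hσ : σ ∈ withTest t) (hx : x ≠ t) :
    ∑ j, (if x ∈ foldImage k σ j then (1 : ℝ) else 0) = 1 := by
  have hne : σ.symm x ≠ Fin.last n := by
    intro h
    rw [Equiv.symm_apply_eq, mem_withTest.mp hσ] at h
    exact hx h
  obtain ⟨i, hi⟩ := Fin.exists_castSucc_eq.mpr hne
  rw [Finset.sum_eq_single (k i)]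
  · rw [if_pos (mem_foldImage.mpr ⟨i, rfl, by rw [hi, Equiv.apply_symm_apply]⟩)]
  · intro j _ hj
    rw [if_neg]
    rw [mem_foldImage]
    rintro ⟨i', rfl, hi'⟩
    rw [← Equiv.eq_symm_apply, ← hi] at hi'
    exact hj (by rw [Fin.castSucc_injective n hi'])
  · simp

lemma card_eq_mul (hk : ∀ j, (Finset.univ.filter fun i => k i = j).card = m) : n = K * m := by
  have := Finset.card_eq_sum_card_fiberwise (s := (Finset.univ : Finset (Fin n)))
    (t := (Finset.univ : Finset (Fin K))) (f := k) (fun _ _ => Finset.mem_univ _)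
  simpa [hk] using this

open scoped Nat in
lemma card_withTest (t : Fin (n + 1)) : (withTest t).card = n ! := by
  have h := card_filter_image_eq (P := {Fin.last n}) (Q := ∅) (R := ∅) (P' := {t}) (Q' := ∅)
    (R' := ∅) (by simp) (by simp) (by simp) (by simp) (by simp) (by simp) rfl rfl rfl
  simpa [withTest] using h

lemma last_not_mem_foldPos (j : Fin K) :
    Disjoint {Fin.last n} ((Finset.univ.filter fun i => k i = j).image Fin.castSucc) := by
  rw [Finset.disjoint_singleton_left, Finset.mem_image]
  rintro ⟨i, -, hi⟩
  exact (Fin.castSucc_lt_last i).ne hi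

open scoped Nat in
lemma card_foldImage_eq (hk : ∀ j, (Finset.univ.filter fun i => k i = j).card = m)
    {t : Fin (n + 1)} {F : Finset (Fin (n + 1))} (hF : F ∈ foldSets m t) (j : Fin K) :
    ((withTest t).filter fun σ => foldImage k σ j = F).card = m ! * (n - m)! := by
  rw [mem_foldSets] at hF
  have h := card_filter_image_eq (P := {Fin.last n})
    (Q := (Finset.univ.filter fun i => k i = j).image Fin.castSucc) (R := ∅) (P' := {t}) (Q' := F)
    (R' := ∅) (last_not_mem_foldPos j) (by simp) (by simp) (by simpa using hF.1)
    (by simp) (by simp) rfl (by rw [hF.2, card_foldPos hk]) rfl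
  rw [card_foldPos hk] at h
  simp only [Finset.card_singleton, Finset.card_empty, Fintype.card_fin, Nat.factorial_one,
    Nat.factorial_zero, one_mul, mul_one, Finset.image_singleton, Finset.singleton_inj,
    Finset.image_empty, and_true] at h
  -- The 1 is the test point, which is fixed along with the fold.
  rw [show n - m = n + 1 - (1 + m + 0) by omega, ← h]
  congr 1
  ext σ
  rw [Finset.mem_filter, mem_withTest]
  simp [foldImage]

open scoped Nat in
lemma card_foldImage_pair_eq (hk : ∀ j, (Finset.univ.filter fun i => k i = j).card = m)
    {t : Fin (n + 1)} {F F' : Finset (Fin (n + 1))} (hF : F ∈ foldSets m t)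
    (hF' : F' ∈ foldSets m t) (hFF' : Disjoint F F') {j j' : Fin K} (hj : j ≠ j') :
    ((withTest t).filter fun σ => foldImage k σ j = F ∧ foldImage k σ j' = F').card
      = m ! * m ! * (n - 2 * m)! := by
  rw [mem_foldSets] at hF hF'
  have h := card_filter_image_eq (P := {Fin.last n})
    (Q := (Finset.univ.filter fun i => k i = j).image Fin.castSucc)
    (R := (Finset.univ.filter fun i => k i = j').image Fin.castSucc) (P' := {t}) (Q' := F)
    (R' := F') (last_not_mem_foldPos j) (last_not_mem_foldPos j') (disjoint_foldPos hj)
    (by simpa using hF.1) (by simpa using hF'.1) hFF' rfl (by rw [hF.2, card_foldPos hk])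
    (by rw [hF'.2, card_foldPos hk])
  rw [card_foldPos hk, card_foldPos hk] at h
  simp only [Finset.card_singleton, Fintype.card_fin, Nat.factorial_one,
    one_mul, Finset.image_singleton, Finset.singleton_inj] at h
  rw [show n - 2 * m = n + 1 - (1 + m + m) by omega, ← h]
  congr 1
  ext σ
  rw [Finset.mem_filter, mem_withTest]
  simp [foldImage]

open scoped Nat in
lemma sum_withTest_foldImage (hk : ∀ j, (Finset.univ.filter fun i => k i = j).card = m)
    (t : Fin (n + 1)) (j : Fin K) (H : Finset (Fin (n + 1)) → ℝ) :
    ∑ σ ∈ withTest t, H (foldImage k σ j)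
      = (m ! * (n - m)! : ℝ) * ∑ F ∈ foldSets m t, H F := by
  rw [← Finset.sum_fiberwise_of_maps_to
    (fun σ hσ => foldImage_mem_foldSets hk hσ j), Finset.mul_sum]
  refine Finset.sum_congr rfl fun F hF => ?_
  rw [Finset.sum_congr rfl (g := fun _ => H F)
    (fun σ hσ => by rw [(Finset.mem_filter.mp hσ).2]), Finset.sum_const,
    card_foldImage_eq hk hF, nsmul_eq_mul]
  push_cast
  ring

open scoped Nat in
lemma sum_withTest_foldImage_pair (hk : ∀ j, (Finset.univ.filter fun i => k i = j).card = m)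
    (t : Fin (n + 1)) {j j' : Fin K} (hj : j ≠ j')
    (H : Finset (Fin (n + 1)) → Finset (Fin (n + 1)) → ℝ) :
    ∑ σ ∈ withTest t, H (foldImage k σ j) (foldImage k σ j')
      = (m ! * m ! * (n - 2 * m)! : ℝ) * ∑ F ∈ foldSets m t,
          ∑ F' ∈ foldSets m t with Disjoint F F', H F F' := by
  have hmap : ∀ σ ∈ withTest t, (foldImage k σ j, foldImage k σ j') ∈
      ((foldSets m t ×ˢ foldSets m t).filter fun p => Disjoint p.1 p.2) := fun σ hσ => by
    rw [Finset.mem_filter, Finset.mem_product]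
    exact ⟨⟨foldImage_mem_foldSets hk hσ j, foldImage_mem_foldSets hk hσ j'⟩,
      disjoint_foldImage hj σ⟩
  have hprod : ∑ F ∈ foldSets m t, ∑ F' ∈ foldSets m t with Disjoint F F', H F F'
      = ∑ p ∈ (foldSets m t ×ˢ foldSets m t).filter fun p => Disjoint p.1 p.2, H p.1 p.2 := by
    rw [Finset.sum_filter, Finset.sum_product]
    exact Finset.sum_congr rfl fun F _ => by rw [Finset.sum_filter]
  rw [hprod, ← Finset.sum_fiberwise_of_maps_to hmap, Finset.mul_sum]
  refine Finset.sum_congr rfl fun p hp => ?_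
  simp only [Finset.mem_filter, Finset.mem_product] at hp
  rw [Finset.sum_congr rfl (g := fun _ => H p.1 p.2)
    (fun σ hσ => by rw [← (Finset.mem_filter.mp hσ).2]), Finset.sum_const, nsmul_eq_mul]
  simp only [Prod.ext_iff]
  rw [card_foldImage_pair_eq hk hp.1.1 hp.1.2 hp.2 hj]
  push_cast
  ring

end Folds

/-! ### Conditional averages given the test point and one fold -/

/-- The average of `b` over the arrangements with test point `t`. -/
def testMean {n : ℕ} (b : Equiv.Perm (Fin (n + 1)) → ℝ) (t : Fin (n + 1)) : ℝ :=
  (∑ σ ∈ withTest t, b σ) / n.factorial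

/-- The average of `b` over the arrangements with test point `t` for which `F` is a fold, each
arrangement being counted once for every position of `F` among the folds. -/
def foldMean {n K : ℕ} (m : ℕ) (k : Fin n → Fin K) (b : Equiv.Perm (Fin (n + 1)) → ℝ)
    (t : Fin (n + 1)) (F : Finset (Fin (n + 1))) : ℝ :=
  (∑ j, ∑ σ ∈ withTest t with foldImage k σ j = F, b σ) /
    (K * (m.factorial * (n - m).factorial))

section Means

variable {n K m : ℕ} {k : Fin n → Fin K} {b : Equiv.Perm (Fin (n + 1)) → ℝ}

-- Since n = Km, n.choose m is K times (n - 1).choose (m - 1), the number of folds through a given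
-- point.
open scoped Nat in
lemma factorial_eq_mul_choose (hK : 0 < K) (hm : 0 < m) (hn : n = K * m) :
    (n ! : ℝ) = (K * (m ! * (n - m)!) : ℝ) * (n - 1).choose (m - 1) := by
  obtain ⟨m, rfl⟩ : ∃ a, m = a + 1 := ⟨m - 1, by omega⟩
  have hmn : m + 1 ≤ n := hn ▸ Nat.le_mul_of_pos_left _ hK
  obtain ⟨n', rfl⟩ : ∃ a, n = a + 1 := ⟨n - 1, by omega⟩
  have h := Nat.choose_mul_factorial_mul_factorial (show m ≤ n' by omega)
  simp only [Nat.add_sub_cancel, Nat.factorial_succ, show n' + 1 - (m + 1) = n' - m by omega]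
  rw [← h]
  have hn' : ((n' : ℝ) + 1) = K * (m + 1) := by exact_mod_cast hn
  push_cast
  rw [hn']
  ring

lemma choose_eq_mul_choose (hm : 0 < m) (hn : n = K * m) (hn0 : 0 < n) :
    (n.choose m : ℝ) = K * (n - 1).choose (m - 1) := by
  obtain ⟨m, rfl⟩ : ∃ a, m = a + 1 := ⟨m - 1, by omega⟩
  obtain ⟨n', rfl⟩ : ∃ a, n = a + 1 := ⟨n - 1, by omega⟩
  have h := Nat.add_one_mul_choose_eq n' m
  have hn' : ((n' : ℝ) + 1) = K * (m + 1) := by exact_mod_cast hn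
  have h' : ((n' : ℝ) + 1) * (n'.choose m) = ((n' + 1).choose (m + 1)) * (m + 1) := by
    exact_mod_cast h
  simp only [Nat.add_sub_cancel]
  have hm0 : ((m : ℝ) + 1) ≠ 0 := by positivity
  apply mul_right_cancel₀ hm0
  rw [← h', hn']
  ring

-- Double counting: the constant is the number of pairs (σ, j) for which σ has test point `t` and
-- puts `F` in position `j`. All averages over folds below are instances with a suitable `H`.
open scoped Nat in
lemma sum_foldMean_mul (hK : 0 < K)
    (hk : ∀ j, (Finset.univ.filter fun i => k i = j).card = m)
    (t : Fin (n + 1)) (H : Finset (Fin (n + 1)) → ℝ) :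
    (K * (m ! * (n - m)!) : ℝ) * ∑ F ∈ foldSets m t, foldMean m k b t F * H F
      = ∑ σ ∈ withTest t, b σ * ∑ j, H (foldImage k σ j) := by
  have hc : (K * (m ! * (n - m)!) : ℝ) ≠ 0 := by positivity
  simp only [Finset.mul_sum]
  rw [Finset.sum_comm (s := withTest t)]
  have : ∀ j : Fin K, ∑ σ ∈ withTest t, b σ * H (foldImage k σ j)
      = ∑ F ∈ foldSets m t, (∑ σ ∈ withTest t with foldImage k σ j = F, b σ) * H F := by
    intro j
    rw [← Finset.sum_fiberwise_of_maps_to (fun σ hσ => foldImage_mem_foldSets hk hσ j)]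
    refine Finset.sum_congr rfl fun F _ => ?_
    rw [Finset.sum_mul]
    exact Finset.sum_congr rfl fun σ hσ => by rw [(Finset.mem_filter.mp hσ).2]
  rw [Finset.sum_congr rfl fun j _ => this j, Finset.sum_comm]
  refine Finset.sum_congr rfl fun F _ => ?_
  rw [foldMean, ← Finset.sum_mul]
  field_simp

lemma foldMean_nonneg (hb0 : ∀ σ, 0 ≤ b σ) (t : Fin (n + 1)) (F : Finset (Fin (n + 1))) :
    0 ≤ foldMean m k b t F :=
  div_nonneg (Finset.sum_nonneg fun _ _ => Finset.sum_nonneg fun σ _ => hb0 σ) (by positivity)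

lemma foldMean_le_one (hK : 0 < K)
    (hk : ∀ j, (Finset.univ.filter fun i => k i = j).card = m) (hb1 : ∀ σ, b σ ≤ 1)
    {t : Fin (n + 1)} {F : Finset (Fin (n + 1))} (hF : F ∈ foldSets m t) :
    foldMean m k b t F ≤ 1 := by
  rw [foldMean, div_le_one (by positivity)]
  calc ∑ j : Fin K, ∑ σ ∈ withTest t with foldImage k σ j = F, b σ
      ≤ ∑ j : Fin K, ∑ σ ∈ withTest t with foldImage k σ j = F, 1 :=
        Finset.sum_le_sum fun _ _ => Finset.sum_le_sum fun σ _ => hb1 σ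
    _ = _ := by
        simp only [Finset.sum_const, card_foldImage_eq hk hF, nsmul_eq_mul, mul_one,
          Finset.card_univ, Fintype.card_fin]
        push_cast
        ring

open scoped Nat in
lemma sum_foldMean (hK : 0 < K) (hm : 0 < m)
    (hk : ∀ j, (Finset.univ.filter fun i => k i = j).card = m) (t : Fin (n + 1)) :
    ∑ F ∈ foldSets m t, foldMean m k b t F
      = K * (n - 1).choose (m - 1) * testMean b t := by
  have hc : (K * (m ! * (n - m)!) : ℝ) ≠ 0 := by positivity
  have h := sum_foldMean_mul (b := b) hK hk t (fun _ => 1)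
  simp only [mul_one, Finset.sum_const, Finset.card_univ, Fintype.card_fin, nsmul_eq_mul] at h
  rw [← Finset.sum_mul] at h
  have hf := factorial_eq_mul_choose hK hm (card_eq_mul hk)
  have hq : ∑ σ ∈ withTest t, b σ = n ! * testMean b t := by
    rw [testMean]; field_simp
  rw [hq, hf] at h
  apply mul_left_cancel₀ hc
  rw [h]
  ring

-- As each point other than `t` lies in exactly one fold, `foldMean` has the same average over the
-- folds through `x` as over all folds. This supplies the second centring condition.
open scoped Nat in
lemma sum_foldMean_mem (hK : 0 < K) (hm : 0 < m)
    (hk : ∀ j, (Finset.univ.filter fun i => k i = j).card = m) {t x : Fin (n + 1)} (hx : x ≠ t) :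
    ∑ F ∈ foldSets m t, foldMean m k b t F * (if x ∈ F then 1 else 0)
      = (n - 1).choose (m - 1) * testMean b t := by
  have hc : (K * (m ! * (n - m)!) : ℝ) ≠ 0 := by positivity
  have h := sum_foldMean_mul (b := b) hK hk t (fun F => if x ∈ F then 1 else 0)
  have hs : ∑ σ ∈ withTest t, b σ * ∑ j, (if x ∈ foldImage k σ j then (1 : ℝ) else 0)
      = ∑ σ ∈ withTest t, b σ :=
    Finset.sum_congr rfl fun σ hσ => by rw [sum_mem_foldImage hσ hx, mul_one]
  rw [hs] at h
  have hf := factorial_eq_mul_choose hK hm (card_eq_mul hk)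
  have hq : ∑ σ ∈ withTest t, b σ = n ! * testMean b t := by
    rw [testMean]; field_simp
  rw [hq, hf] at h
  apply mul_left_cancel₀ hc
  rw [h]
  ring

lemma card_foldSets_mem (hm : 0 < m) {t x : Fin (n + 1)} (hx : x ≠ t) :
    ∑ F ∈ foldSets m t, (if x ∈ F then (1 : ℝ) else 0) = (n - 1).choose (m - 1) := by
  rw [Finset.sum_boole]
  congr 1
  have hc : ((Finset.univ.erase t).erase x).card = n - 1 := by
    rw [Finset.card_erase_of_mem (by simp [hx]), Finset.card_erase_of_mem (by simp)]
    simp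
  rw [← hc, ← Finset.card_powersetCard]
  refine Finset.card_bij' (fun F _ => F.erase x) (fun F _ => insert x F) ?_ ?_ ?_ ?_
  · intro F hF
    simp only [Finset.mem_filter, mem_foldSets] at hF
    rw [Finset.mem_powersetCard, Finset.card_erase_of_mem hF.2, hF.1.2]
    refine ⟨fun y hy => ?_, rfl⟩
    simp only [Finset.mem_erase, Finset.mem_univ, and_true] at hy ⊢
    exact ⟨hy.1, fun h => hF.1.1 (h ▸ hy.2)⟩
  · intro F hF
    rw [Finset.mem_powersetCard] at hF
    have hxF : x ∉ F := fun h => by simpa using hF.1 h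
    have htF : t ∉ F := fun h => by simpa using hF.1 h
    simp only [Finset.mem_filter, mem_foldSets, Finset.mem_insert_self, and_true,
      Finset.mem_insert, Finset.card_insert_of_notMem hxF, hF.2, not_or]
    exact ⟨⟨hx.symm, htF⟩, by omega⟩
  · intro F hF
    exact Finset.insert_erase (Finset.mem_filter.mp hF).2
  · intro F hF
    rw [Finset.mem_powersetCard] at hF
    exact Finset.erase_insert fun h => by simpa using hF.1 h

open scoped Nat in
/-- If sums over the folds of centred functions of one fold have a second moment that is at most
`c` times as large as if the folds were independent, then the variance of `b` bounds the variance
of its conditional average given one fold. -/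
lemma sum_sq_foldMean_sub_le (hK : 0 < K) (hm : 0 < m)
    (hk : ∀ j, (Finset.univ.filter fun i => k i = j).card = m)
    (hb : ∀ σ, b σ = 0 ∨ b σ = 1) (t : Fin (n + 1)) {c : ℝ} (hc0 : 0 ≤ c)
    (hc : ∀ g : Finset (Fin (n + 1)) → ℝ, ∑ F ∈ foldSets m t, g F = 0 →
      (∀ x, x ≠ t → ∑ F ∈ foldSets m t, g F * (if x ∈ F then 1 else 0) = 0) →
      ∑ σ ∈ withTest t, (∑ j, g (foldImage k σ j)) ^ 2
        ≤ c * ((K * (m ! * (n - m)!) : ℝ) * ∑ F ∈ foldSets m t, g F ^ 2)) :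
    ∑ F ∈ foldSets m t, (foldMean m k b t F - testMean b t) ^ 2
      ≤ c * (n - 1).choose (m - 1) * (testMean b t - testMean b t ^ 2) := by
  set q := testMean b t with hqdef
  set N : ℝ := (((n - 1).choose (m - 1) : ℕ) : ℝ) with hN
  set g : Finset (Fin (n + 1)) → ℝ := fun F => foldMean m k b t F - q with hg
  set Q := ∑ F ∈ foldSets m t, g F ^ 2 with hQ
  set κ : ℝ := K * (m ! * (n - m)!) with hκdef
  have hn := card_eq_mul hk
  have hn0 : 0 < n := hn ▸ Nat.mul_pos hK hm
  have hκ : 0 < κ := by positivity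
  have hf : (n ! : ℝ) = κ * N := factorial_eq_mul_choose hK hm hn
  have hq : ∑ σ ∈ withTest t, b σ = n ! * q := by
    rw [hqdef, testMean]; field_simp
  have hg0 : ∑ F ∈ foldSets m t, g F = 0 := by
    simp only [hg, Finset.sum_sub_distrib, sum_foldMean hK hm hk, Finset.sum_const,
      card_foldSets, nsmul_eq_mul, choose_eq_mul_choose hm hn hn0]
    simp [hqdef]
  have hg1 : ∀ x, x ≠ t → ∑ F ∈ foldSets m t, g F * (if x ∈ F then 1 else 0) = 0 := by
    intro x hx
    simp only [hg, sub_mul, Finset.sum_sub_distrib, sum_foldMean_mem hK hm hk hx,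
      ← Finset.mul_sum, card_foldSets_mem hm hx]
    rw [hqdef]; ring
  have hG := hc g hg0 hg1
  -- Duality: `g` is tested against itself, so its squared norm becomes a correlation of `b` with
  -- the sum of `g` over the folds.
  have h1 : κ * Q = ∑ σ ∈ withTest t, b σ * ∑ j, g (foldImage k σ j) := by
    rw [← sum_foldMean_mul hK hk t g]
    congr 1
    have : ∀ F, g F ^ 2 = foldMean m k b t F * g F - q * g F := fun F => by simp only [hg]; ring
    rw [hQ, Finset.sum_congr rfl fun F _ => this F, Finset.sum_sub_distrib, ← Finset.mul_sum, hg0]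
    simp
  have h2 : ∑ σ ∈ withTest t, ∑ j, g (foldImage k σ j) = 0 := by
    rw [Finset.sum_comm]
    simp [sum_withTest_foldImage hk, hg0]
  have h3 : κ * Q = ∑ σ ∈ withTest t, (b σ - q) * ∑ j, g (foldImage k σ j) := by
    simp only [sub_mul, Finset.sum_sub_distrib, ← Finset.mul_sum, h2]
    rw [h1]; simp
  -- Bernoulli variance, as `b` is 0 or 1.
  have h4 : ∑ σ ∈ withTest t, (b σ - q) ^ 2 = n ! * (q - q ^ 2) := by
    have : ∀ σ, (b σ - q) ^ 2 = b σ - 2 * q * b σ + q ^ 2 := fun σ => by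
      rcases hb σ with h | h <;> rw [h] <;> ring
    simp only [this, Finset.sum_add_distrib, Finset.sum_sub_distrib, ← Finset.mul_sum, hq,
      Finset.sum_const, card_withTest, nsmul_eq_mul]
    ring
  have h5 : (κ * Q) ^ 2 ≤ (n ! * (q - q ^ 2)) * (c * (κ * Q)) := by
    rw [← h4]
    calc (κ * Q) ^ 2 ≤ _ := by rw [h3]; exact Finset.sum_mul_sq_le_sq_mul_sq _ _ _
      _ ≤ _ := mul_le_mul_of_nonneg_left hG (Finset.sum_nonneg fun _ _ => sq_nonneg _)
  have hQ0 : 0 ≤ Q := Finset.sum_nonneg fun _ _ => sq_nonneg _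
  have hv : 0 ≤ q - q ^ 2 := by
    have : 0 ≤ (n ! : ℝ) * (q - q ^ 2) := h4 ▸ Finset.sum_nonneg fun _ _ => sq_nonneg _
    exact nonneg_of_mul_nonneg_right this (by positivity)
  -- `Q` occurs squared on the left of `h5` and once on the right; one factor is cancelled unless it
  -- vanishes.
  rcases hQ0.eq_or_lt with h | h
  · rw [← h]; positivity
  · rw [hf] at h5
    have h6 : κ * Q * (κ * Q) ≤ κ * Q * (κ * (c * N * (q - q ^ 2))) := by
      nlinarith [h5]
    exact le_of_mul_le_mul_left (le_of_mul_le_mul_left h6 (by positivity)) hκ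

end Means

/-! ### Second moments of sums over the folds -/

section SecondMoment

variable {n K m : ℕ} {k : Fin n → Fin K}

-- Cauchy–Schwarz over the `K` folds of each arrangement; no centring is needed.
open scoped Nat in
lemma sum_sq_sum_le_card_mul (hk : ∀ j, (Finset.univ.filter fun i => k i = j).card = m)
    (t : Fin (n + 1)) (g : Finset (Fin (n + 1)) → ℝ) :
    ∑ σ ∈ withTest t, (∑ j, g (foldImage k σ j)) ^ 2
      ≤ K * ((K * (m ! * (n - m)!) : ℝ) * ∑ F ∈ foldSets m t, g F ^ 2) := by
  calc ∑ σ ∈ withTest t, (∑ j, g (foldImage k σ j)) ^ 2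
      ≤ ∑ σ ∈ withTest t, K * ∑ j, g (foldImage k σ j) ^ 2 := by
        refine Finset.sum_le_sum fun σ _ => ?_
        simpa using sq_sum_le_card_mul_sum_sq (s := Finset.univ)
          (f := fun j => g (foldImage k σ j))
    _ = _ := by
        rw [← Finset.mul_sum, Finset.sum_comm,
          Finset.sum_congr rfl fun j _ => sum_withTest_foldImage hk t j (fun F => g F ^ 2)]
        simp only [Finset.sum_const, Finset.card_univ, Fintype.card_fin, nsmul_eq_mul]
        ring

lemma card_foldSets_disjoint {t : Fin (n + 1)} {F : Finset (Fin (n + 1))}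
    (hF : F ∈ foldSets m t) :
    ((foldSets m t).filter fun F' => Disjoint F F').card = (n - m).choose m := by
  rw [mem_foldSets] at hF
  have hc : ((Finset.univ.erase t) \ F).card = n - m := by
    rw [Finset.card_sdiff_of_subset (by simpa [Finset.subset_erase] using hF.1), hF.2]
    simp
  rw [← hc, ← Finset.card_powersetCard]
  congr 1
  ext F'
  simp only [foldSets, Finset.mem_filter, Finset.mem_powersetCard, Finset.subset_sdiff,
    disjoint_comm (a := F)]
  tauto

/-- Let `g` be a function of sets of size `m` that is centred, also on the sets that contain any
given point. Its sum of products over the pairs of disjoint sets is bounded in terms of the number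
of common points beyond the first of a pair of sets. -/
lemma sum_disjoint_mul_le (hm : 0 < m) (hn : n = K * m) (hn0 : 0 < n) (t : Fin (n + 1))
    {g : Finset (Fin (n + 1)) → ℝ}
    (hg0 : ∑ F ∈ foldSets m t, g F = 0)
    (hg1 : ∀ x, x ≠ t → ∑ F ∈ foldSets m t, g F * (if x ∈ F then 1 else 0) = 0) :
    ∑ F ∈ foldSets m t, ∑ F' ∈ foldSets m t with Disjoint F F', g F * g F'
      ≤ ((n - m).choose m - (K - m) * (n - 1).choose (m - 1) : ℝ)
        * ∑ F ∈ foldSets m t, g F ^ 2 := by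
  set r : Finset (Fin (n + 1)) → Finset (Fin (n + 1)) → ℝ := fun F F' => ((F ∩ F').card : ℝ)
  -- This kernel is (|F ∩ F'| - 1)⁺. It differs from the disjointness indicator by |F ∩ F'| - 1,
  -- which the two centring conditions annihilate.
  set a : Finset (Fin (n + 1)) → Finset (Fin (n + 1)) → ℝ :=
    fun F F' => (if Disjoint F F' then 1 else 0) - 1 + r F F' with ha
  have hr : ∀ F F', r F F' = ∑ x ∈ F, if x ∈ F' then (1 : ℝ) else 0 := fun F F' => by
    rw [Finset.sum_boole, Finset.filter_mem_eq_inter]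
  have hxt : ∀ F ∈ foldSets m t, ∀ x ∈ F, x ≠ t := fun F hF x hx h =>
    (mem_foldSets.mp hF).1 (h ▸ hx)
  have ha0 : ∀ F F', 0 ≤ a F F' := fun F F' => by
    simp only [ha]
    split_ifs with h
    · simp [r]
    · rw [Finset.disjoint_iff_inter_eq_empty, ← Finset.card_eq_zero] at h
      have : (1 : ℝ) ≤ r F F' := Nat.one_le_cast.mpr (Nat.one_le_iff_ne_zero.mpr h)
      linarith
  have hsymm : ∀ F F', a F F' = a F' F := fun F F' => by
    simp only [ha, r, disjoint_comm (a := F), Finset.inter_comm F]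
  have hasum : ∀ F ∈ foldSets m t, ∑ F' ∈ foldSets m t, a F F'
      = ((n - m).choose m - (K - m) * (n - 1).choose (m - 1) : ℝ) := fun F hF => by
    have h1 : ∑ F' ∈ foldSets m t, r F F' = m * (n - 1).choose (m - 1) := by
      simp only [hr]
      rw [Finset.sum_comm, Finset.sum_congr rfl fun x hx => card_foldSets_mem hm (hxt F hF x hx),
        Finset.sum_const, (mem_foldSets.mp hF).2, nsmul_eq_mul]
    simp only [ha, Finset.sum_add_distrib, Finset.sum_sub_distrib, h1, Finset.sum_boole,
      card_foldSets_disjoint hF, Finset.sum_const, card_foldSets, nsmul_eq_mul,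
      choose_eq_mul_choose hm hn hn0]
    ring
  have hzero : ∑ F ∈ foldSets m t, ∑ F' ∈ foldSets m t, (1 - r F F') * (g F * g F') = 0 := by
    refine Finset.sum_eq_zero fun F hF => ?_
    have h1 : ∑ F' ∈ foldSets m t, r F F' * g F' = 0 := by
      simp only [hr, Finset.sum_mul]
      rw [Finset.sum_comm]
      refine Finset.sum_eq_zero fun x hx => ?_
      exact (Finset.sum_congr rfl fun _ _ => mul_comm _ _).trans (hg1 x (hxt F hF x hx))
    calc ∑ F' ∈ foldSets m t, (1 - r F F') * (g F * g F')
        = g F * (∑ F' ∈ foldSets m t, g F' - ∑ F' ∈ foldSets m t, r F F' * g F') := by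
          rw [← Finset.sum_sub_distrib, Finset.mul_sum]
          exact Finset.sum_congr rfl fun _ _ => by ring
      _ = 0 := by rw [hg0, h1]; ring
  calc ∑ F ∈ foldSets m t, ∑ F' ∈ foldSets m t with Disjoint F F', g F * g F'
      = ∑ F ∈ foldSets m t, ∑ F' ∈ foldSets m t,
          ((1 - r F F') * (g F * g F') + a F F' * (g F * g F')) := by
        refine Finset.sum_congr rfl fun F _ => ?_
        rw [Finset.sum_filter]
        refine Finset.sum_congr rfl fun F' _ => ?_
        simp only [ha]
        split_ifs <;> ring
    _ = ∑ F ∈ foldSets m t, ∑ F' ∈ foldSets m t, a F F' * (g F * g F') := by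
        simp only [Finset.sum_add_distrib]
        rw [hzero, zero_add]
    -- Schur test: for a symmetric nonnegative kernel with constant row sums, the row sum bounds the
    -- quadratic form.
    _ ≤ ∑ F ∈ foldSets m t, ∑ F' ∈ foldSets m t,
          (a F F' * g F ^ 2 / 2 + a F' F * g F' ^ 2 / 2) := by
        refine Finset.sum_le_sum fun F _ => Finset.sum_le_sum fun F' _ => ?_
        rw [hsymm F' F]
        nlinarith [mul_nonneg (ha0 F F') (sq_nonneg (g F - g F'))]
    _ = ∑ F ∈ foldSets m t, ∑ F' ∈ foldSets m t, a F F' * g F ^ 2 := by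
        simp only [Finset.sum_add_distrib]
        rw [Finset.sum_comm (f := fun F F' => a F' F * g F' ^ 2 / 2), ← Finset.sum_add_distrib]
        refine Finset.sum_congr rfl fun F _ => ?_
        rw [← Finset.sum_add_distrib]
        exact Finset.sum_congr rfl fun _ _ => by ring
    _ = _ := by
        rw [Finset.mul_sum]
        refine Finset.sum_congr rfl fun F hF => ?_
        rw [← Finset.sum_mul, hasum F hF]

-- The diagonal terms contribute 1 to the factor m + 1, and the pairs of distinct folds contribute
-- at most m, by `sum_disjoint_mul_le`.
open scoped Nat in
lemma sum_sq_sum_le_succ_mul (hK : 0 < K) (hm : 0 < m)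
    (hk : ∀ j, (Finset.univ.filter fun i => k i = j).card = m)
    (t : Fin (n + 1)) {g : Finset (Fin (n + 1)) → ℝ}
    (hg0 : ∑ F ∈ foldSets m t, g F = 0)
    (hg1 : ∀ x, x ≠ t → ∑ F ∈ foldSets m t, g F * (if x ∈ F then 1 else 0) = 0) :
    ∑ σ ∈ withTest t, (∑ j, g (foldImage k σ j)) ^ 2
      ≤ (m + 1) * ((K * (m ! * (n - m)!) : ℝ) * ∑ F ∈ foldSets m t, g F ^ 2) := by
  have hn := card_eq_mul hk
  have hn0 : 0 < n := hn ▸ Nat.mul_pos hK hm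
  set Q := ∑ F ∈ foldSets m t, g F ^ 2 with hQ
  have hQ0 : 0 ≤ Q := Finset.sum_nonneg fun _ _ => sq_nonneg _
  -- For K ≤ m + 1 the bound with factor `K` is already enough. Otherwise K - m > 0, which fixes the
  -- sign used in `hKX`, and two disjoint folds fit.
  rcases le_or_gt K (m + 1) with hKm | hKm
  · refine (sum_sq_sum_le_card_mul hk t g).trans ?_
    have : (K : ℝ) ≤ m + 1 := by exact_mod_cast hKm
    exact mul_le_mul_of_nonneg_right this (by positivity)
  set κ : ℝ := m ! * (n - m)! with hκdef
  set κ' : ℝ := m ! * m ! * (n - 2 * m)! with hκ'def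
  set X := ∑ F ∈ foldSets m t, ∑ F' ∈ foldSets m t with Disjoint F F', g F * g F' with hX
  have hsum : ∑ σ ∈ withTest t, (∑ j, g (foldImage k σ j)) ^ 2
      = K * (κ * Q) + K * (K - 1) * (κ' * X) := by
    have hexp : ∀ σ, (∑ j, g (foldImage k σ j)) ^ 2
        = ∑ j, ∑ j', g (foldImage k σ j) * g (foldImage k σ j') := fun σ => by
      rw [sq, Finset.sum_mul_sum]
    simp only [hexp]
    rw [Finset.sum_comm]
    have hj : ∀ j : Fin K, ∑ σ ∈ withTest t, ∑ j', g (foldImage k σ j) * g (foldImage k σ j')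
        = κ * Q + (K - 1) * (κ' * X) := fun j => by
      rw [Finset.sum_comm, ← Finset.add_sum_erase _ _ (Finset.mem_univ j)]
      congr 1
      · rw [hQ, hκdef, ← sum_withTest_foldImage hk t j]
        exact Finset.sum_congr rfl fun _ _ => (sq _).symm
      · rw [Finset.sum_congr rfl fun j' hj' => sum_withTest_foldImage_pair hk t
          (Finset.ne_of_mem_erase hj').symm (fun F F' => g F * g F'), Finset.sum_const,
          Finset.card_erase_of_mem (Finset.mem_univ j), nsmul_eq_mul]
        rw [Finset.card_univ, Fintype.card_fin, Nat.cast_sub (by omega), Nat.cast_one]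
    rw [Finset.sum_congr rfl fun j _ => hj j, Finset.sum_const, Finset.card_univ,
      Fintype.card_fin, nsmul_eq_mul]
    ring
  have hXle := sum_disjoint_mul_le hm hn hn0 t hg0 hg1
  rw [← hX, ← hQ] at hXle
  have h2m : m ≤ n - m := by
    have : 2 * m ≤ K * m := Nat.mul_le_mul_right _ (by omega)
    omega
  -- Once one fold is fixed, a second one is chosen among the remaining n - m points.
  have hκκ' : κ' * (n - m).choose m = κ := by
    have h := Nat.choose_mul_factorial_mul_factorial h2m
    rw [show n - m - m = n - 2 * m by omega] at h
    rw [hκdef, hκ'def, ← h]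
    push_cast
    ring
  have hchoose : ((n - m).choose m : ℝ) ≤ K * (n - 1).choose (m - 1) := by
    rw [← choose_eq_mul_choose hm hn hn0]
    exact_mod_cast Nat.choose_le_choose m (Nat.sub_le n m)
  have hKm' : (m : ℝ) + 1 < K := by exact_mod_cast hKm
  have hm' : (1 : ℝ) ≤ m := by exact_mod_cast hm
  have hκ'0 : 0 < κ' := by positivity
  have hKX : K * X ≤ m * (n - m).choose m * Q := by
    calc K * X ≤ K * (((n - m).choose m - (K - m) * (n - 1).choose (m - 1) : ℝ) * Q) :=
          mul_le_mul_of_nonneg_left hXle (by positivity)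
      _ = (K * (n - m).choose m - (K - m) * (K * (n - 1).choose (m - 1)) : ℝ) * Q := by ring
      _ ≤ (K * (n - m).choose m - (K - m) * (n - m).choose m : ℝ) * Q := by
          refine mul_le_mul_of_nonneg_right ?_ hQ0
          have := mul_le_mul_of_nonneg_left hchoose (show (0 : ℝ) ≤ K - m by linarith)
          linarith
      _ = _ := by ring
  have h1 : κ' * (K * X) ≤ m * (κ * Q) := by
    calc κ' * (K * X) ≤ κ' * (m * (n - m).choose m * Q) :=
          mul_le_mul_of_nonneg_left hKX hκ'0.le
      _ = m * ((κ' * (n - m).choose m) * Q) := by ring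
      _ = _ := by rw [hκκ']
  have hκQ : 0 ≤ m * (κ * Q) := by positivity
  have h2 : (K - 1) * (κ' * (K * X)) ≤ (K - 1) * (m * (κ * Q)) :=
    mul_le_mul_of_nonneg_left h1 (by linarith)
  rw [hsum]
  nlinarith [h2, hκQ]

end SecondMoment

/-! ### The number of arrangements with a large test score -/

/-- The number of points in `F` whose score is at least that of `t`, when the scores are computed
for the set that consists of `t` and `F`. -/
def foldLoss {α : Type*} [DecidableEq α] (r : Finset α → α → ℝ) (t : α) (F : Finset α) : ℝ :=
  ∑ x ∈ F, if r (insert t F) t ≤ r (insert t F) x then 1 else 0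

/-- The left side sums w t * w x over ordered pairs of distinct points. One of r t ≤ r x and r x ≤ r
t holds, and weights in [0, 1] make the product at most the weight of whichever point loses the
comparison; ties only help. -/
lemma sum_sq_sub_sum_sq_le {α : Type*} [DecidableEq α] (A : Finset α) (w r : α → ℝ)
    (hw0 : ∀ t ∈ A, 0 ≤ w t) (hw1 : ∀ t ∈ A, w t ≤ 1) :
    (∑ t ∈ A, w t) ^ 2 - ∑ t ∈ A, w t ^ 2
      ≤ 2 * ∑ t ∈ A, w t * ∑ x ∈ A.erase t, if r t ≤ r x then 1 else 0 := by
  set d : α → α → ℝ := fun t x => if t ≠ x ∧ r t ≤ r x then 1 else 0 with hd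
  have hR : ∑ t ∈ A, w t * ∑ x ∈ A.erase t, (if r t ≤ r x then (1 : ℝ) else 0)
      = ∑ t ∈ A, ∑ x ∈ A, w t * d t x := by
    refine Finset.sum_congr rfl fun t _ => ?_
    rw [← Finset.mul_sum, ← Finset.filter_ne, Finset.sum_filter]
    congr 1
    refine Finset.sum_congr rfl fun x _ => ?_
    simp only [hd, ite_and]
  have hL : (∑ t ∈ A, w t) ^ 2 - ∑ t ∈ A, w t ^ 2
      = ∑ t ∈ A, ∑ x ∈ A, if t ≠ x then w t * w x else 0 := by
    rw [sq, Finset.sum_mul_sum, ← Finset.sum_sub_distrib]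
    refine Finset.sum_congr rfl fun t ht => ?_
    rw [← Finset.sum_filter, Finset.filter_ne, ← Finset.add_sum_erase _ _ ht]
    ring
  have hR2 : 2 * ∑ t ∈ A, ∑ x ∈ A, w t * d t x
      = ∑ t ∈ A, ∑ x ∈ A, (w t * d t x + w x * d x t) := by
    simp only [Finset.sum_add_distrib]
    rw [Finset.sum_comm (f := fun t x => w x * d x t), two_mul]
  rw [hR, hR2, hL]
  refine Finset.sum_le_sum fun t ht => Finset.sum_le_sum fun x hx => ?_
  have h1 : w t * w x ≤ w t := mul_le_of_le_one_right (hw0 t ht) (hw1 x hx)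
  have h2 : w t * w x ≤ w x := mul_le_of_le_one_left (hw0 x hx) (hw1 t ht)
  have ht0 := hw0 t ht
  have hx0 := hw0 x hx
  by_cases htx : t = x
  · simp [hd, htx]
  · simp only [hd, ne_eq, htx, not_false_eq_true, true_and, Ne.symm htx]
    rcases le_total (r t) (r x) with h | h
    · rw [if_pos h]
      split_ifs <;> linarith
    · rw [if_pos h]
      split_ifs <;> linarith

section Main

variable {n K m : ℕ} {k : Fin n → Fin K}

/-- A test point with a fold is the same as a set of m + 1 points with a distinguished element. This
change of view exposes the symmetry between the test point and the fold. -/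
lemma sum_foldSets_eq_sum_powersetCard (H : Fin (n + 1) → Finset (Fin (n + 1)) → ℝ) :
    ∑ t, ∑ F ∈ foldSets m t, H t F
      = ∑ A ∈ Finset.univ.powersetCard (m + 1), ∑ t ∈ A, H t (A.erase t) := by
  rw [Finset.sum_sigma', Finset.sum_sigma']
  refine Finset.sum_bij' (fun p _ => ⟨insert p.1 p.2, p.1⟩) (fun p _ => ⟨p.2, p.1.erase p.2⟩)
    ?_ ?_ ?_ ?_ ?_
  · rintro ⟨t, F⟩ h
    simp only [Finset.mem_sigma, Finset.mem_univ, true_and, mem_foldSets] at h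
    simp [Finset.mem_powersetCard, Finset.card_insert_of_notMem h.1, h.2]
  · rintro ⟨A, t⟩ h
    simp only [Finset.mem_sigma, Finset.mem_powersetCard, Finset.subset_univ, true_and] at h
    simp [mem_foldSets, Finset.card_erase_of_mem h.2, h.1]
  · rintro ⟨t, F⟩ h
    simp only [Finset.mem_sigma, Finset.mem_univ, true_and, mem_foldSets] at h
    simp [Finset.erase_insert h.1]
  · rintro ⟨A, t⟩ h
    simp only [Finset.mem_sigma] at h
    simp [Finset.insert_erase h.2]
  · rintro ⟨t, F⟩ h
    simp only [Finset.mem_sigma, Finset.mem_univ, true_and, mem_foldSets] at h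
    simp [Finset.erase_insert h.1]

/-- The right side involves `v` only through its sums over all folds and over the folds through a
point. Applied both to `foldMean` and to the constant q t, it shows that their difference, summed
over A, is orthogonal to ∑ q. -/
lemma sum_mul_sum_of_star {N : ℝ} {q : Fin (n + 1) → ℝ}
    {v : Fin (n + 1) → Finset (Fin (n + 1)) → ℝ}
    (hv0 : ∀ t, ∑ F ∈ foldSets m t, v t F = K * N * q t)
    (hv1 : ∀ t x, x ≠ t → ∑ F ∈ foldSets m t, v t F * (if x ∈ F then 1 else 0) = N * q t) :
    ∑ A ∈ Finset.univ.powersetCard (m + 1), (∑ t ∈ A, v t (A.erase t)) * ∑ t ∈ A, q t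
      = N * ((∑ t, q t) ^ 2 + (K - 1) * ∑ t, q t ^ 2) := by
  have h1 : ∀ A : Finset (Fin (n + 1)), (∑ t ∈ A, v t (A.erase t)) * ∑ t ∈ A, q t
      = ∑ t ∈ A, v t (A.erase t) * (q t + ∑ x ∈ A.erase t, q x) := fun A => by
    rw [Finset.sum_mul]
    exact Finset.sum_congr rfl fun t ht => by rw [Finset.add_sum_erase _ _ ht]
  rw [Finset.sum_congr rfl fun A _ => h1 A,
    ← sum_foldSets_eq_sum_powersetCard (fun t F => v t F * (q t + ∑ x ∈ F, q x))]
  have h2 : ∀ t, ∑ F ∈ foldSets m t, v t F * (q t + ∑ x ∈ F, q x)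
      = N * (q t * ∑ x, q x + (K - 1) * q t ^ 2) := fun t => by
    have h3 : ∑ F ∈ foldSets m t, v t F * ∑ x ∈ F, q x
        = ∑ x ∈ Finset.univ.erase t, N * q t * q x := by
      have h4 : ∀ F ∈ foldSets m t, v t F * ∑ x ∈ F, q x
          = ∑ x ∈ Finset.univ.erase t, v t F * (if x ∈ F then 1 else 0) * q x := fun F hF => by
        have hs : F ⊆ Finset.univ.erase t := (Finset.mem_powersetCard.mp hF).1
        rw [Finset.mul_sum, ← Finset.sum_subset hs]
        · exact Finset.sum_congr rfl fun x hx => by rw [if_pos hx, mul_one]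
        · intro x _ hx
          rw [if_neg hx]; ring
      rw [Finset.sum_congr rfl h4, Finset.sum_comm]
      refine Finset.sum_congr rfl fun x hx => ?_
      rw [← Finset.sum_mul, hv1 t x (Finset.ne_of_mem_erase hx)]
    simp only [mul_add, Finset.sum_add_distrib]
    rw [h3, ← Finset.sum_mul, hv0, ← Finset.mul_sum, ← Finset.add_sum_erase _ _ (Finset.mem_univ t)]
    ring
  rw [Finset.sum_congr rfl fun t _ => h2 t, ← Finset.mul_sum, Finset.sum_add_distrib,
    ← Finset.sum_mul, ← Finset.mul_sum]
  ring

open scoped Nat in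
/-- If `b` indicates arrangements in which at most `ℓ` points have a score that is at least that of
the test point, then the proportion of such arrangements is at most `(2 ℓ + c) / (n + c)`. -/
theorem sum_indicator_mul_le (hK : 0 < K) (hm : 0 < m)
    (hk : ∀ j, (Finset.univ.filter fun i => k i = j).card = m)
    (r : Finset (Fin (n + 1)) → Fin (n + 1) → ℝ)
    {b : Equiv.Perm (Fin (n + 1)) → ℝ} (hb : ∀ σ, b σ = 0 ∨ b σ = 1) {ℓ : ℝ} (hℓ : 0 ≤ ℓ)
    (hbℓ : ∀ σ, b σ * ∑ j, foldLoss r (σ (Fin.last n)) (foldImage k σ j) ≤ ℓ * b σ)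
    {c : ℝ} (hc1 : 1 ≤ c)
    (hc : ∀ t, ∑ F ∈ foldSets m t, (foldMean m k b t F - testMean b t) ^ 2
      ≤ c * (n - 1).choose (m - 1) * (testMean b t - testMean b t ^ 2)) :
    (∑ σ, b σ) * (n + c) ≤ (2 * ℓ + c) * (n + 1)! := by
  have hn := card_eq_mul hk
  have hn0 : 0 < n := hn ▸ Nat.mul_pos hK hm
  have hmn : m ≤ n := hn ▸ Nat.le_mul_of_pos_left _ hK
  set N : ℝ := (((n - 1).choose (m - 1) : ℕ) : ℝ) with hN
  have hN0 : 0 < N := Nat.cast_pos.mpr (Nat.choose_pos (by omega))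
  set q := testMean b with hqdef
  set w := foldMean m k b with hwdef
  set s := ∑ t, q t with hs
  set κ : ℝ := K * (m ! * (n - m)!) with hκdef
  have hκ : 0 < κ := by positivity
  have hf : (n ! : ℝ) = κ * N := factorial_eq_mul_choose hK hm hn
  have hb0 : ∀ σ, 0 ≤ b σ := fun σ => by rcases hb σ with h | h <;> simp [h]
  have hb1 : ∀ σ, b σ ≤ 1 := fun σ => by rcases hb σ with h | h <;> simp [h]
  have hq : ∀ t, ∑ σ ∈ withTest t, b σ = n ! * q t := fun t => by
    rw [hqdef, testMean]; field_simp
  have hbs : ∑ σ, b σ = n ! * s := by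
    rw [hs, Finset.mul_sum, ← Finset.sum_congr rfl fun t _ => hq t]
    exact (Finset.sum_fiberwise Finset.univ (fun σ : Equiv.Perm (Fin (n + 1)) => σ (Fin.last n))
      b).symm
  have hq0 : ∀ t, 0 ≤ q t := fun t =>
    div_nonneg (Finset.sum_nonneg fun σ _ => hb0 σ) (by positivity)
  have hs0 : 0 ≤ s := Finset.sum_nonneg fun t _ => hq0 t
  have hloss : ∀ t, ∑ F ∈ foldSets m t, w t F * foldLoss r t F ≤ ℓ * N * q t := fun t => by
    have h := sum_foldMean_mul (b := b) hK hk t (foldLoss r t)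
    have h' : ∑ σ ∈ withTest t, b σ * ∑ j, foldLoss r t (foldImage k σ j)
        ≤ ∑ σ ∈ withTest t, ℓ * b σ := Finset.sum_le_sum fun σ hσ => by
      have := hbℓ σ
      rwa [mem_withTest.mp hσ] at this
    rw [← h, ← Finset.mul_sum, hq t, hf] at h'
    refine le_of_mul_le_mul_left ?_ hκ
    calc _ ≤ _ := h'
      _ = _ := by ring
  have hpair : ∑ A ∈ Finset.univ.powersetCard (m + 1),
      ((∑ t ∈ A, w t (A.erase t)) ^ 2 - ∑ t ∈ A, w t (A.erase t) ^ 2) ≤ 2 * (ℓ * N * s) := by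
    calc _ ≤ ∑ A ∈ Finset.univ.powersetCard (m + 1),
          2 * ∑ t ∈ A, w t (A.erase t) * foldLoss r t (A.erase t) := by
          refine Finset.sum_le_sum fun A hA => ?_
          have hAt : ∀ t ∈ A, A.erase t ∈ foldSets m t := fun t ht => by
            rw [mem_foldSets, Finset.card_erase_of_mem ht, (Finset.mem_powersetCard.mp hA).2]
            simp
          refine (sum_sq_sub_sum_sq_le A (fun t => w t (A.erase t)) (r A)
            (fun t _ => foldMean_nonneg hb0 t _)
            (fun t ht => foldMean_le_one hK hk hb1 (hAt t ht))).trans_eq ?_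
          congr 1
          refine Finset.sum_congr rfl fun t ht => ?_
          rw [foldLoss, Finset.insert_erase ht]
      _ = 2 * ∑ t, ∑ F ∈ foldSets m t, w t F * foldLoss r t F := by
          rw [← Finset.mul_sum,
            sum_foldSets_eq_sum_powersetCard (fun t F => w t F * foldLoss r t F)]
      _ ≤ 2 * ∑ t, ℓ * N * q t :=
          mul_le_mul_of_nonneg_left (Finset.sum_le_sum fun t _ => hloss t) (by norm_num)
      _ = _ := by rw [← Finset.mul_sum]
  have hWQ := sum_mul_sum_of_star (m := m) (K := K) (N := N) (q := q) (v := w)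
    (fun t => sum_foldMean hK hm hk t) (fun t x hx => sum_foldMean_mem hK hm hk hx)
  have hQQ := sum_mul_sum_of_star (m := m) (K := K) (N := N) (q := q) (v := fun t _ => q t)
    (fun t => by
      rw [Finset.sum_const, card_foldSets, nsmul_eq_mul, choose_eq_mul_choose hm hn hn0])
    (fun t x hx => by rw [← Finset.mul_sum, card_foldSets_mem hm hx, mul_comm])
  rw [← hs] at hWQ hQQ
  set q2 := ∑ t, q t ^ 2 with hq2
  have hW2 : N * (s ^ 2 + (K - 1) * q2)
      ≤ ∑ A ∈ Finset.univ.powersetCard (m + 1), (∑ t ∈ A, w t (A.erase t)) ^ 2 := by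
    -- Expansion of (W - Q)² ≥ 0, with W and Q the sums of w and q over A; `hWQ` and `hQQ` have the
    -- same value.
    have h : ∑ A ∈ Finset.univ.powersetCard (m + 1),
        (2 * ((∑ t ∈ A, w t (A.erase t)) * ∑ t ∈ A, q t) - (∑ t ∈ A, q t) * ∑ t ∈ A, q t)
        ≤ ∑ A ∈ Finset.univ.powersetCard (m + 1), (∑ t ∈ A, w t (A.erase t)) ^ 2 :=
      Finset.sum_le_sum fun A _ => by
        nlinarith [sq_nonneg ((∑ t ∈ A, w t (A.erase t)) - ∑ t ∈ A, q t)]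
    rw [Finset.sum_sub_distrib, ← Finset.mul_sum, hWQ, hQQ] at h
    linarith
  have hw2 : ∑ A ∈ Finset.univ.powersetCard (m + 1), ∑ t ∈ A, w t (A.erase t) ^ 2
      ≤ N * (c * (s - q2) + K * q2) := by
    rw [← sum_foldSets_eq_sum_powersetCard (fun t F => w t F ^ 2)]
    have ht : ∀ t, ∑ F ∈ foldSets m t, w t F ^ 2
        ≤ N * (c * (q t - q t ^ 2) + K * q t ^ 2) := fun t => by
      have h1 : ∀ F, (w t F - q t) ^ 2 = w t F ^ 2 - 2 * q t * w t F + q t ^ 2 := fun F => by ring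
      have h2 := hc t
      rw [Finset.sum_congr rfl fun F _ => h1 F, Finset.sum_add_distrib, Finset.sum_sub_distrib,
        ← Finset.mul_sum, sum_foldMean hK hm hk, Finset.sum_const, card_foldSets, nsmul_eq_mul,
        choose_eq_mul_choose hm hn hn0] at h2
      linarith
    refine (Finset.sum_le_sum fun t _ => ht t).trans_eq ?_
    rw [← Finset.mul_sum, Finset.sum_add_distrib, ← Finset.mul_sum, ← Finset.mul_sum,
      Finset.sum_sub_distrib]
  rw [Finset.sum_sub_distrib] at hpair
  -- The terms K * q2 cancel between `hW2` and `hw2`, so `K` disappears and only `c` remains.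
  have hmain : s ^ 2 - c * s + (c - 1) * q2 ≤ 2 * ℓ * s := by
    refine le_of_mul_le_mul_left ?_ hN0
    linarith
  have hcs : s ^ 2 ≤ (n + 1) * q2 := by
    have := sq_sum_le_card_mul_sum_sq (s := (Finset.univ : Finset (Fin (n + 1)))) (f := q)
    simpa using this
  have hfin : s * (n + c) ≤ (2 * ℓ + c) * (n + 1) := by
    rcases hs0.eq_or_lt with h | h
    · rw [← h, zero_mul]; positivity
    · refine le_of_mul_le_mul_left ?_ h
      nlinarith [mul_le_mul_of_nonneg_left hcs (sub_nonneg.mpr hc1)]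
  rw [hbs, Nat.factorial_succ]
  push_cast
  have hfac : (0 : ℝ) ≤ n ! := by positivity
  nlinarith [mul_le_mul_of_nonneg_left hfin hfac]

end Main

/-! ### A closed form of the score -/

section Score

variable {C : ℕ} {p : Fin C → ℝ} {ρ : Equiv.Perm (Fin C)}

lemma Precedes.trans {x y z : Fin C} (hxy : Precedes p ρ x y) (hyz : Precedes p ρ y z) :
    Precedes p ρ x z := by
  unfold Precedes at *
  rcases hxy with h | ⟨h, h'⟩ <;> rcases hyz with g | ⟨g, g'⟩
  · exact Or.inl (g.trans h)
  · exact Or.inl (g ▸ h)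
  · exact Or.inl (h ▸ g)
  · exact Or.inr ⟨h.trans g, h'.trans g'⟩

lemma not_precedes_self (y : Fin C) : ¬ Precedes p ρ y y := by
  simp [Precedes]

lemma precedes_or_eq_or_precedes (y z : Fin C) :
    Precedes p ρ y z ∨ y = z ∨ Precedes p ρ z y := by
  unfold Precedes
  rcases lt_trichotomy (p y) (p z) with h | h | h
  · exact Or.inr (Or.inr (Or.inl h))
  · rcases lt_trichotomy (ρ y) (ρ z) with g | g | g
    · exact Or.inl (Or.inr ⟨h, g⟩)
    · exact Or.inr (Or.inl (ρ.injective g))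
    · exact Or.inr (Or.inr (Or.inr ⟨h.symm, g⟩))
  · exact Or.inl (Or.inl h)

lemma rank_lt_rank_of_precedes {y z : Fin C} (h : Precedes p ρ z y) : rank p ρ z < rank p ρ y := by
  unfold rank
  refine Nat.add_lt_add_right (Finset.card_lt_card ?_) 1
  refine Finset.ssubset_iff_of_subset (fun x hx => ?_) |>.mpr ⟨z, ?_, ?_⟩
  · simp only [Finset.mem_filter, Finset.mem_univ, true_and] at hx ⊢
    exact hx.trans h
  · simpa using h
  · simpa using not_precedes_self z

lemma rank_lt_rank_iff {y z : Fin C} : rank p ρ z < rank p ρ y ↔ Precedes p ρ z y := by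
  refine ⟨fun h => ?_, rank_lt_rank_of_precedes⟩
  rcases precedes_or_eq_or_precedes (p := p) (ρ := ρ) z y with g | rfl | g
  · exact g
  · exact absurd h (lt_irrefl _)
  · exact absurd h (rank_lt_rank_of_precedes g).not_gt

lemma rank_injective : Function.Injective (rank p ρ) := fun y z h => by
  rcases precedes_or_eq_or_precedes (p := p) (ρ := ρ) y z with g | g | g
  · exact absurd h (rank_lt_rank_of_precedes g).ne
  · exact g
  · exact absurd h (rank_lt_rank_of_precedes g).ne'

lemma rank_pos (y : Fin C) : 1 ≤ rank p ρ y := Nat.le_add_left _ _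

lemma rank_le (y : Fin C) : rank p ρ y ≤ C := by
  classical
  unfold rank
  have : (Finset.univ.filter fun z => Precedes p ρ z y) ⊂ Finset.univ :=
    (Finset.ssubset_iff_of_subset (Finset.subset_univ _)).mpr
      ⟨y, Finset.mem_univ y, by simpa using not_precedes_self y⟩
  have h := Finset.card_lt_card this
  rw [Finset.card_univ, Fintype.card_fin] at h
  exact Nat.succ_le_of_lt (by convert h)

lemma orderStat_rank (y : Fin C) : orderStat p ρ (rank p ρ y) = p y := by
  have : (Finset.univ.filter fun z => rank p ρ z = rank p ρ y) = {y} := by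
    ext z
    simp [rank_injective.eq_iff]
  rw [orderStat, this, Finset.sum_singleton]

lemma cumProb_eq_sum (c : ℕ) : cumProb p ρ c = ∑ y with rank p ρ y ≤ c, p y := by
  unfold cumProb orderStat
  rw [← Finset.sum_fiberwise_of_maps_to (s := Finset.univ.filter fun y => rank p ρ y ≤ c)
    (t := Finset.Icc 1 c) (g := rank p ρ)]
  · refine Finset.sum_congr rfl fun j hj => ?_
    congr 1
    ext y
    simp only [Finset.mem_filter, Finset.mem_univ, true_and, Finset.mem_Icc] at hj ⊢
    omega
  · intro y hy
    simp only [Finset.mem_filter, Finset.mem_univ, true_and, Finset.mem_Icc] at hy ⊢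
    exact ⟨rank_pos y, hy⟩

lemma cumProb_mono (hp : p ∈ stdSimplex ℝ (Fin C)) : Monotone (cumProb p ρ) := fun c d h => by
  rw [cumProb_eq_sum, cumProb_eq_sum]
  refine Finset.sum_le_sum_of_subset_of_nonneg (fun y hy => ?_) fun y _ _ => hp.1 y
  simp only [Finset.mem_filter, Finset.mem_univ, true_and] at hy ⊢
  omega

lemma cumProb_card (hp : p ∈ stdSimplex ℝ (Fin C)) : cumProb p ρ C = 1 := by
  rw [cumProb_eq_sum, Finset.filter_true_of_mem fun y _ => rank_le y, hp.2]

open Classical in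
/-- The closed form of the score of the label `y`: the probability of the labels that precede `y`,
plus the fraction `1 - u` of the probability of `y`. -/
def scoreFormula (p : Fin C → ℝ) (ρ : Equiv.Perm (Fin C)) (y : Fin C) (u : ℝ) : ℝ :=
  (∑ z, if Precedes p ρ z y then p z else 0) + (1 - u) * p y

lemma cumProb_rank_sub_one (y : Fin C) :
    cumProb p ρ (rank p ρ y - 1) + p y = cumProb p ρ (rank p ρ y) := by
  rw [cumProb_eq_sum, cumProb_eq_sum]
  have : (Finset.univ.filter fun z => rank p ρ z ≤ rank p ρ y)
      = insert y (Finset.univ.filter fun z => rank p ρ z ≤ rank p ρ y - 1) := by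
    ext z
    have h1 := rank_pos (p := p) (ρ := ρ) y
    have h2 := rank_injective.eq_iff (f := rank p ρ) (a := z) (b := y)
    simp only [Finset.mem_filter, Finset.mem_univ, true_and, Finset.mem_insert, ← h2]
    omega
  rw [this, Finset.sum_insert, add_comm]
  have h1 := rank_pos (p := p) (ρ := ρ) y
  simp only [Finset.mem_filter, Finset.mem_univ, true_and]
  omega

lemma scoreFormula_eq (y : Fin C) (u : ℝ) :
    scoreFormula p ρ y u = cumProb p ρ (rank p ρ y) - u * p y := by
  classical
  rw [← cumProb_rank_sub_one, scoreFormula, cumProb_eq_sum, ← Finset.sum_filter]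
  have : (Finset.univ.filter fun z => Precedes p ρ z y)
      = Finset.univ.filter fun z => rank p ρ z ≤ rank p ρ y - 1 := by
    ext z
    have h1 := rank_pos (p := p) (ρ := ρ) y
    simp only [Finset.mem_filter, Finset.mem_univ, true_and, ← rank_lt_rank_iff]
    omega
  rw [this]
  ring

lemma scoreFormula_mem_Icc (hp : p ∈ stdSimplex ℝ (Fin C)) (y : Fin C) {u : ℝ}
    (hu : u ∈ Set.Ioo (0 : ℝ) 1) : scoreFormula p ρ y u ∈ Set.Icc (0 : ℝ) 1 := by
  have hy := hp.1 y
  constructor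
  · refine add_nonneg (Finset.sum_nonneg fun z _ => ?_) (mul_nonneg (by linarith [hu.2]) hy)
    split_ifs
    exacts [hp.1 z, le_rfl]
  · rw [scoreFormula_eq, ← cumProb_card (ρ := ρ) hp]
    have := cumProb_mono (ρ := ρ) hp (rank_le (p := p) (ρ := ρ) y)
    have := mul_nonneg hu.1.le hy
    linarith

/-- The randomization matters only when `y` sits exactly at position L; there u ≤ V, multiplied by p
y, is the comparison of τ with the closed form. -/
lemma mem_genSet_iff (hp : p ∈ stdSimplex ℝ (Fin C)) (y : Fin C) {u τ : ℝ}
    (hu : u ∈ Set.Ioo (0 : ℝ) 1) (hτ1 : τ ≤ 1) :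
    y ∈ genSet p ρ u τ ↔ scoreFormula p ρ y u < τ := by
  rw [scoreFormula_eq]
  set S : Set ℕ := {c | c ∈ Finset.Icc 1 C ∧ τ ≤ cumProb p ρ c} with hS
  have hne : S.Nonempty :=
    ⟨C, by simp [Nat.one_le_iff_ne_zero, Nat.pos_iff_ne_zero.mp y.pos], by rwa [cumProb_card hp]⟩
  have hmem : genQuantile p ρ τ ∈ S := Nat.sInf_mem hne
  have hlt : ∀ c, 1 ≤ c → c < genQuantile p ρ τ → cumProb p ρ c < τ := fun c hc1 hc => by
    by_contra! h
    have hL := (Finset.mem_Icc.mp hmem.1).2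
    exact Nat.notMem_of_lt_sInf hc ⟨Finset.mem_Icc.mpr ⟨hc1, by omega⟩, h⟩
  have hpy := hp.1 y
  have hr := rank_pos (p := p) (ρ := ρ) y
  have hstep := cumProb_rank_sub_one (p := p) (ρ := ρ) y
  have htop : ∀ c, y ∈ topLabels p ρ c ↔ rank p ρ y ≤ c := fun c => by simp [topLabels]
  have hif : y ∈ genSet p ρ u τ ↔ if u ≤ genV p ρ τ then rank p ρ y ≤ genQuantile p ρ τ - 1
      else rank p ρ y ≤ genQuantile p ρ τ := by
    unfold genSet
    split_ifs <;> rw [htop]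
  rw [hif]
  have hL1 := (Finset.mem_Icc.mp hmem.1).1
  rcases lt_trichotomy (genQuantile p ρ τ) (rank p ρ y) with h | h | h
  · have h1 : τ ≤ cumProb p ρ (rank p ρ y - 1) :=
      hmem.2.trans (cumProb_mono hp (by omega))
    have h2 : u * p y ≤ p y := mul_le_of_le_one_left hpy hu.2.le
    have h3 : ¬ cumProb p ρ (rank p ρ y) - u * p y < τ := by linarith
    simp only [h3, iff_false]
    split_ifs <;> omega
  -- A label of zero probability cannot sit at position L: the previous position would already reach
  -- τ, or, at position 1, all probabilities would vanish.
  · have hpos : 0 < p y := by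
      rcases hpy.eq_or_lt with h0 | h0
      · exfalso
        rw [← h0, add_zero] at hstep
        rcases hr.eq_or_lt with h1 | h1
        · have hz : ∀ z, p z ≤ 0 := fun z => by
            rcases precedes_or_eq_or_precedes (p := p) (ρ := ρ) z y with g | rfl | g
            · have := rank_lt_rank_of_precedes g
              have := rank_pos (p := p) (ρ := ρ) z
              omega
            · exact h0.ge
            · rcases g with g | g
              · exact h0 ▸ g.le
              · exact (g.1 ▸ h0).ge
          have := Finset.sum_nonpos fun z (_ : z ∈ Finset.univ) => hz z
          rw [hp.2] at this
          linarith
        · have := hlt (rank p ρ y - 1) (by omega) (by omega)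
          have := hmem.2
          rw [h] at this
          linarith
      · exact h0
    have hV : u ≤ genV p ρ τ ↔ u * p y ≤ cumProb p ρ (rank p ρ y) - τ := by
      rw [genV, h, orderStat_rank, le_div_iff₀ hpos]
    rw [h]
    split_ifs with h1 <;> rw [hV] at h1
    · exact ⟨fun h2 => by omega, fun h2 => by linarith⟩
    · exact ⟨fun _ => by linarith, fun _ => le_rfl⟩
  · have h1 := hlt _ hr h
    have h2 := mul_nonneg hu.1.le hpy
    have h3 : cumProb p ρ (rank p ρ y) - u * p y < τ := by linarith
    simp only [h3, iff_true]
    split_ifs <;> omega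

lemma coe_score (hp : p ∈ stdSimplex ℝ (Fin C)) (y : Fin C) {u : ℝ}
    (hu : u ∈ Set.Ioo (0 : ℝ) 1) : (score p ρ y u : ℝ) = scoreFormula p ρ y u := by
  set s : unitInterval := ⟨scoreFormula p ρ y u, scoreFormula_mem_Icc hp y hu⟩ with hs
  have hset : {τ : unitInterval | y ∈ genSet p ρ u (τ : ℝ)} = Set.Ioi s := by
    ext τ
    rw [Set.mem_ofPred_eq, mem_genSet_iff hp y hu τ.2.2, Set.mem_Ioi, ← Subtype.coe_lt_coe]
  have : score p ρ y u = s := by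
    rw [score, hset]
    -- This also covers s = 1, where the set is empty and its infimum in [0, 1] is 1.
    refine le_antisymm (le_of_forall_gt_imp_ge_of_dense fun τ hτ => sInf_le hτ) ?_
    exact le_sInf fun τ hτ => le_of_lt hτ
  rw [this]

end Score

/-! ### Miscoverage for a rearrangement of the samples -/

/-- The labelled samples, the split, and the uniform variables and tie-breaking orders of the
samples. -/
abbrev Sample (𝒳 : Type*) (C n K : ℕ) : Type _ :=
  (Fin (n + 1) → 𝒳 × Fin C) × (Fin n → Fin K) × (Fin (n + 1) → ℝ) ×
    (Fin (n + 1) → Equiv.Perm (Fin C))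

/-- Permute the labelled samples together with their uniform variables and tie-breaking orders;
the split of the positions does not change. -/
def rearrange {𝒳 : Type*} {C n K : ℕ} (σ : Equiv.Perm (Fin (n + 1))) (d : Sample 𝒳 C n K) :
    Sample 𝒳 C n K :=
  (fun i => d.1 (σ i), d.2.1, fun i => d.2.2.1 (σ i), fun i => d.2.2.2 (σ i))

/-- The score of the sample `x` under the classifier trained without the fold of `i`. -/
def foldScore {𝒳 : Type*} {C n K : ℕ} (B : Learner 𝒳 C) (d : Sample 𝒳 C n K) (i : Fin n)
    (x : Fin (n + 1)) : ℝ :=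
  scoreFormula (foldClassifier B (fun i => d.1 i.castSucc) d.2.1 (d.2.1 i) (d.1 x).1) (d.2.2.2 x)
    (d.1 x).2 (d.2.2.1 x)

/-- The label of the last sample is not in the prediction set. -/
def Miscovers {𝒳 : Type*} {C n K : ℕ} (B : Learner 𝒳 C) (α : ℝ) (d : Sample 𝒳 C n K) : Prop :=
  (1 - α) * ((n : ℝ) + 1) ≤
    ∑ i : Fin n, if foldScore B d i i.castSucc < foldScore B d i (Fin.last n) then (1 : ℝ) else 0

/-- The score of the sample `x` under the classifier trained on the samples outside of `A`. -/
def complScore {𝒳 : Type*} {C n K : ℕ} (B : Learner 𝒳 C) (d : Sample 𝒳 C n K)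
    (A : Finset (Fin (n + 1))) (x : Fin (n + 1)) : ℝ :=
  scoreFormula (B (((List.finRange (n + 1)).filter fun i => i ∉ A).map d.1) (d.1 x).1) (d.2.2.2 x)
    (d.1 x).2 (d.2.2.1 x)

section Rearrange

variable {𝒳 : Type*} {C n K : ℕ} {B : Learner 𝒳 C}

/-- The training points are exactly those outside the test point and the fold of `i`, in an order
that the learner ignores. So the score depends on the arrangement only through this set and the
point scored. -/
lemma foldScore_rearrange (hB : B.PermInvariant) (d : Sample 𝒳 C n K)
    (σ : Equiv.Perm (Fin (n + 1))) (i : Fin n) (x : Fin (n + 1)) :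
    foldScore B (rearrange σ d) i x
      = complScore B d (insert (σ (Fin.last n)) (foldImage d.2.1 σ (d.2.1 i))) (σ x) := by
  have hperm : ((((List.finRange n).filter fun i' => d.2.1 i' ≠ d.2.1 i).map
      fun i' => σ i'.castSucc)).Perm ((List.finRange (n + 1)).filter fun y =>
        y ∉ insert (σ (Fin.last n)) (foldImage d.2.1 σ (d.2.1 i))) := by
    rw [List.perm_ext_iff_of_nodup]
    · intro y
      simp only [List.mem_map, List.mem_filter, List.mem_finRange, true_and, decide_eq_true_eq,
        Finset.mem_insert, mem_foldImage, not_or, not_exists, not_and]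
      constructor
      · rintro ⟨i', hi', rfl⟩
        refine ⟨fun h => (Fin.castSucc_lt_last i').ne (σ.injective h), fun a ha h => hi' ?_⟩
        rw [← ha, Fin.castSucc_injective n (σ.injective h)]
      · rintro ⟨h1, h2⟩
        have hne : σ.symm y ≠ Fin.last n := fun h => h1 (by rw [← h, Equiv.apply_symm_apply])
        obtain ⟨i', hi'⟩ := Fin.exists_castSucc_eq.mpr hne
        have hy : σ i'.castSucc = y := by rw [hi', Equiv.apply_symm_apply]
        exact ⟨i', fun h => h2 i' h hy, hy⟩
    · exact ((List.nodup_finRange n).filter _).map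
        fun a a' h => Fin.castSucc_injective n (σ.injective h)
    · exact (List.nodup_finRange _).filter _
  have hmap := hB _ _ (hperm.map d.1)
  rw [List.map_map] at hmap
  rw [foldScore, complScore, ← hmap]
  rfl

/-- The losses count the complement of the strict comparisons in `Miscovers`, hence n - (1 - α)(n +
1). -/
lemma sum_foldLoss_complScore_le (hB : B.PermInvariant) {α : ℝ} {d : Sample 𝒳 C n K}
    {σ : Equiv.Perm (Fin (n + 1))} (h : Miscovers B α (rearrange σ d)) :
    ∑ j, foldLoss (complScore B d) (σ (Fin.last n)) (foldImage d.2.1 σ j)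
      ≤ α * (n + 1) - 1 := by
  have h1 : ∑ j, foldLoss (complScore B d) (σ (Fin.last n)) (foldImage d.2.1 σ j)
      = ∑ i : Fin n, (1 - if foldScore B (rearrange σ d) i i.castSucc
          < foldScore B (rearrange σ d) i (Fin.last n) then (1 : ℝ) else 0) := by
    rw [← Finset.sum_fiberwise Finset.univ d.2.1]
    refine Finset.sum_congr rfl fun j _ => ?_
    rw [foldLoss, sum_foldImage]
    refine Finset.sum_congr rfl fun i hi => ?_
    rw [foldScore_rearrange hB, foldScore_rearrange hB, (Finset.mem_filter.mp hi).2]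
    split_ifs <;> linarith
  rw [h1, Finset.sum_sub_distrib]
  have h2 : (1 - α) * ((n : ℝ) + 1) ≤ _ := h
  simp only [Finset.sum_const, Finset.card_univ, Fintype.card_fin, nsmul_eq_mul, mul_one]
  linarith

/-- With c = K and c = m + 1, the hypotheses say that (P - 2α)(n + c) is at most c - 2 - 2α(c - 1),
which is slightly stronger than what is claimed. -/
lemma le_min_bound {K m n : ℕ} (hK : 0 < K) (hm : 0 < m) (hn : n = K * m) {α P : ℝ}
    (hα : 0 ≤ α) (h1 : P * (n + K) ≤ 2 * (α * (n + 1) - 1) + K)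
    (h2 : P * (n + (m + 1)) ≤ 2 * (α * (n + 1) - 1) + (m + 1)) :
    P ≤ 2 * α + min (2 * (1 - 1 / (K : ℝ)) / ((n : ℝ) / K + 1))
        ((1 - (K : ℝ) / n) / ((K : ℝ) + 1)) := by
  have hK' : (1 : ℝ) ≤ K := by exact_mod_cast hK
  have hm' : (1 : ℝ) ≤ m := by exact_mod_cast hm
  have hn' : (n : ℝ) = K * m := by exact_mod_cast hn
  have hK0 : (0 : ℝ) < K := by linarith
  have hm0 : (0 : ℝ) < m := by linarith
  rw [← min_add_add_left, le_min_iff]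
  have e1 : 2 * (1 - 1 / (K : ℝ)) / ((n : ℝ) / K + 1) = 2 * (K - 1) / (n + K) := by
    rw [hn']; field_simp
  have e2 : (1 - (K : ℝ) / n) / ((K : ℝ) + 1) = (m - 1) / (n + m) := by
    rw [hn']; field_simp
  have hn0 : (0 : ℝ) < n := by rw [hn']; positivity
  rw [e1, e2]
  constructor
  · rw [← sub_le_iff_le_add', le_div_iff₀ (by positivity)]
    nlinarith [mul_nonneg hα (sub_nonneg.mpr hK')]
  · have h3 : (P - 2 * α) * (n + m + 1) ≤ m - 1 := by nlinarith
    rw [← sub_le_iff_le_add', le_div_iff₀ (by positivity)]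
    -- The factor n + m + 1 is lowered to n + m, which is harmless if P ≥ 2α; otherwise the left
    -- side is nonpositive.
    rcases le_total (P - 2 * α) 0 with h | h
    · nlinarith [mul_nonneg_of_nonpos_of_nonpos h (neg_nonpos.mpr (by positivity : (0:ℝ) ≤ n + m))]
    · nlinarith

lemma min_bound_nonneg {K n : ℕ} (hK : 0 < K) (hKn : K ≤ n) :
    0 ≤ min (2 * (1 - 1 / (K : ℝ)) / ((n : ℝ) / K + 1)) ((1 - (K : ℝ) / n) / ((K : ℝ) + 1)) := by
  have hK' : (1 : ℝ) ≤ K := by exact_mod_cast hK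
  have hKn' : (K : ℝ) ≤ n := by exact_mod_cast hKn
  have h1 : 1 / (K : ℝ) ≤ 1 := by rw [div_le_one (by linarith)]; exact hK'
  have h2 : (K : ℝ) / n ≤ 1 := by rw [div_le_one (by linarith)]; exact hKn'
  refine le_min (div_nonneg (by linarith) (by positivity)) (div_nonneg (by linarith) (by positivity))

open Classical in
/-- Whatever the samples are, the proportion of their rearrangements for which the label of the
test point is not covered is bounded. -/
theorem card_miscovers_rearrange_le (hB : B.PermInvariant) (hn : 0 < n) (hKn : K ∣ n) {α : ℝ}
    (hα : 0 ≤ α) (d : Sample 𝒳 C n K) (hd : IsSplit d.2.1) :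
    ∑ σ : Equiv.Perm (Fin (n + 1)), (if Miscovers B α (rearrange σ d) then (1 : ℝ) else 0)
      ≤ (2 * α + min (2 * (1 - 1 / (K : ℝ)) / ((n : ℝ) / K + 1))
        ((1 - (K : ℝ) / n) / ((K : ℝ) + 1))) * (n + 1).factorial := by
  have hK : 0 < K := Nat.pos_of_dvd_of_pos hKn hn
  have hm : 0 < n / K := Nat.div_pos (Nat.le_of_dvd hn hKn) hK
  have hnm : n = K * (n / K) := (Nat.mul_div_cancel' hKn).symm
  set m := n / K with hmdef
  have hfac : (0 : ℝ) < (n + 1).factorial := by positivity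
  set b : Equiv.Perm (Fin (n + 1)) → ℝ :=
    fun σ => if Miscovers B α (rearrange σ d) then 1 else 0 with hb
  have hb01 : ∀ σ, b σ = 0 ∨ b σ = 1 := fun σ => by
    simp only [hb]; split_ifs <;> simp
  have hbℓ : ∀ σ, b σ * ∑ j, foldLoss (complScore B d) (σ (Fin.last n)) (foldImage d.2.1 σ j)
      ≤ (α * (n + 1) - 1) * b σ := fun σ => by
    simp only [hb]
    split_ifs with h
    · rw [one_mul, mul_one]
      exact sum_foldLoss_complScore_le hB h
    · simp
  -- For α(n + 1) < 1 no arrangement can miscover, since losses are nonnegative.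
  rcases lt_or_ge (α * ((n : ℝ) + 1) - 1) 0 with hℓ | hℓ
  · have hb0 : ∀ σ, b σ = 0 := fun σ => by
      simp only [hb]
      rw [if_neg]
      intro h
      have h1 := sum_foldLoss_complScore_le hB h
      have h2 : 0 ≤ ∑ j, foldLoss (complScore B d) (σ (Fin.last n)) (foldImage d.2.1 σ j) :=
        Finset.sum_nonneg fun j _ => Finset.sum_nonneg fun x _ => by split_ifs <;> norm_num
      linarith
    rw [Finset.sum_eq_zero fun σ _ => hb0 σ]
    have := min_bound_nonneg hK (Nat.le_of_dvd hn hKn)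
    positivity
  · rw [← div_le_iff₀ hfac]
    refine le_min_bound hK hm hnm hα ?_ ?_
    · rw [div_mul_eq_mul_div, div_le_iff₀ hfac]
      exact sum_indicator_mul_le hK hm hd (complScore B d) hb01 hℓ hbℓ
        (by exact_mod_cast hK) fun t => sum_sq_foldMean_sub_le hK hm hd hb01 t (by positivity)
          fun g _ _ => sum_sq_sum_le_card_mul hd t g
    · rw [div_mul_eq_mul_div, div_le_iff₀ hfac]
      exact sum_indicator_mul_le hK hm hd (complScore B d) hb01 hℓ hbℓ
        (by linarith [(by positivity : (0 : ℝ) ≤ m)]) fun t =>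
          sum_sq_foldMean_sub_le hK hm hd hb01 t (by positivity)
            fun g hg0 hg1 => sum_sq_sum_le_succ_mul hK hm hd t hg0 hg1

end Rearrange

/-! ### Measurability of miscoverage -/

section Measurability

variable {𝒳 : Type*} [MeasurableSpace 𝒳] {C n K : ℕ} {B : Learner 𝒳 C}

instance permMeasurableSingletonClass (C : ℕ) : MeasurableSingletonClass (Equiv.Perm (Fin C)) :=
  ⟨fun _ => trivial⟩

/-- The order and the label take finitely many values, so they may be fixed. -/
lemma measurable_scoreFormula :
    Measurable fun q : (Equiv.Perm (Fin C) × Fin C) × (Fin C → ℝ) × ℝ =>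
      scoreFormula q.2.1 q.1.1 q.1.2 q.2.2 := by
  classical
  refine measurable_from_prod_countable_right fun r => ?_
  unfold scoreFormula
  have hp : ∀ z, Measurable fun q : (Fin C → ℝ) × ℝ => q.1 z := fun z =>
    (measurable_pi_apply z).comp measurable_fst
  refine (Finset.measurable_fun_sum _ fun z _ => ?_).add
    ((measurable_const.sub measurable_snd).mul (hp r.2))
  refine Measurable.ite ?_ (hp z) measurable_const
  exact (measurableSet_lt (hp r.2) (hp z)).union
    ((measurableSet_eq_fun (hp z) (hp r.2)).inter (MeasurableSet.const (r.1 z < r.1 r.2)))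

lemma measurable_learner_map (hB : B.JointlyMeasurable) {ι : Type*} (l : List ι) :
    Measurable fun q : (ι → 𝒳 × Fin C) × 𝒳 => B (l.map q.1) q.2 := by
  refine measurable_pi_lambda _ fun y => ?_
  have h : Measurable fun q : (ι → 𝒳 × Fin C) × 𝒳 =>
      ((fun a : Fin l.length => q.1 (l.get a), q.2) : (Fin l.length → 𝒳 × Fin C) × 𝒳) :=
    (measurable_pi_lambda _ fun a => (measurable_pi_apply _).comp measurable_fst).prodMk
      measurable_snd
  have h' := (hB l.length y).comp h
  convert h' using 2 with q
  simp only [Function.comp_apply]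
  have hl : List.ofFn (fun a : Fin l.length => q.1 (l.get a)) = l.map q.1 := by
    conv_rhs => rw [← List.ofFn_get l, List.map_ofFn]
    rfl
  rw [hl]

lemma measurable_foldScore (hB : B.JointlyMeasurable) (i : Fin n) (x : Fin (n + 1)) :
    Measurable fun d : Sample 𝒳 C n K => foldScore B d i x := by
  have hz : ∀ y, Measurable fun d : Sample 𝒳 C n K => d.1 y := fun y =>
    (measurable_pi_apply y).comp measurable_fst
  have hclass : Measurable fun d : Sample 𝒳 C n K =>
      foldClassifier B (fun i => d.1 i.castSucc) d.2.1 (d.2.1 i) (d.1 x).1 := by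
    have h : Measurable fun q : (Fin n → Fin K) × (Fin n → 𝒳 × Fin C) × 𝒳 =>
        foldClassifier B q.2.1 q.1 (q.1 i) q.2.2 :=
      measurable_from_prod_countable_right fun kk =>
        measurable_learner_map hB ((List.finRange n).filter fun i' => kk i' ≠ kk i)
    exact h.comp (measurable_snd.fst.prodMk ((measurable_pi_lambda _ fun i => hz _).prodMk
      (hz x).fst))
  exact measurable_scoreFormula.comp
    ((((measurable_pi_apply x).comp measurable_snd.snd.snd).prodMk (hz x).snd).prodMk
      (hclass.prodMk ((measurable_pi_apply x).comp measurable_snd.snd.fst)))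

lemma measurableSet_miscovers (hB : B.JointlyMeasurable) (α : ℝ) :
    MeasurableSet {d : Sample 𝒳 C n K | Miscovers B α d} :=
  measurableSet_le measurable_const (Finset.measurable_fun_sum _ fun i _ =>
    Measurable.ite (measurableSet_lt (measurable_foldScore hB i _) (measurable_foldScore hB i _))
      measurable_const measurable_const)

lemma measurable_rearrange (σ : Equiv.Perm (Fin (n + 1))) :
    Measurable (rearrange σ : Sample 𝒳 C n K → Sample 𝒳 C n K) :=
  (measurable_pi_lambda _ fun _ => (measurable_pi_apply _).comp measurable_fst).prodMk
    (measurable_snd.fst.prodMk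
      ((measurable_pi_lambda _ fun _ => (measurable_pi_apply _).comp measurable_snd.snd.fst).prodMk
        (measurable_pi_lambda _ fun _ => (measurable_pi_apply _).comp measurable_snd.snd.snd)))

end Measurability

/-! ### Exchangeability of the samples together with their randomization -/

section Exchange

variable {Ω : Type*} [MeasurableSpace Ω] {μ : Measure Ω} [IsProbabilityMeasure μ]

lemma exchangeable_of_iIndepFun {ι 𝒵 : Type*} [Fintype ι] [MeasurableSpace 𝒵] {Z : ι → Ω → 𝒵}
    (hZ : ∀ i, Measurable (Z i)) (hindep : iIndepFun Z μ)
    (hident : ∀ i j, μ.map (Z i) = μ.map (Z j)) : Exchangeable Z μ := fun σ => by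
  rw [(iIndepFun_iff_map_fun_eq_pi_map fun i => (hZ i).aemeasurable).mp hindep,
    (iIndepFun_iff_map_fun_eq_pi_map fun i => (hZ (σ i)).aemeasurable).mp
      (hindep.precomp σ.injective)]
  congr 1
  funext i
  exact hident _ _

/-- The joint law is a product, and each of the three permuted factors is exchangeable. The split is
not permuted, so its law is arbitrary. -/
lemma map_rearrange_eq {𝒳 : Type*} [MeasurableSpace 𝒳] {C n K : ℕ}
    {Z : Fin (n + 1) → Ω → 𝒳 × Fin C} {k : Ω → Fin n → Fin K} {U : Fin (n + 1) → Ω → ℝ}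
    {R : Fin (n + 1) → Ω → Equiv.Perm (Fin C)} (hZ : ∀ i, Measurable (Z i)) (hk : Measurable k)
    (hU : ∀ i, Measurable (U i)) (hR : ∀ i, Measurable (R i))
    (hZe : Exchangeable Z μ) (hUe : Exchangeable U μ) (hRe : Exchangeable R μ)
    (h₁ : IndepFun (fun ω i => Z i ω) (fun ω => (k ω, (fun i => U i ω), (fun i => R i ω))) μ)
    (h₂ : IndepFun k (fun ω => ((fun i => U i ω), (fun i => R i ω))) μ)
    (h₃ : IndepFun (fun ω i => U i ω) (fun ω i => R i ω) μ) (σ : Equiv.Perm (Fin (n + 1))) :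
    μ.map (fun ω => rearrange σ
        ((fun i => Z i ω, k ω, fun i => U i ω, fun i => R i ω) : Sample 𝒳 C n K))
      = μ.map (fun ω => (fun i => Z i ω, k ω, fun i => U i ω, fun i => R i ω)) := by
  have key : ∀ τ : Equiv.Perm (Fin (n + 1)),
      μ.map (fun ω => ((fun i => Z (τ i) ω, k ω, fun i => U (τ i) ω, fun i => R (τ i) ω) :
        Sample 𝒳 C n K))
      = (μ.map fun ω i => Z (τ i) ω).prod ((μ.map k).prod
        ((μ.map fun ω i => U (τ i) ω).prod (μ.map fun ω i => R (τ i) ω))) := by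
    intro τ
    have mZ : Measurable fun ω i => Z (τ i) ω := measurable_pi_lambda _ fun i => hZ _
    have mU : Measurable fun ω i => U (τ i) ω := measurable_pi_lambda _ fun i => hU _
    have mR : Measurable fun ω i => R (τ i) ω := measurable_pi_lambda _ fun i => hR _
    have i₃ : IndepFun (fun ω i => U (τ i) ω) (fun ω i => R (τ i) ω) μ :=
      h₃.comp (measurable_pi_lambda _ fun i => measurable_pi_apply (τ i))
        (measurable_pi_lambda _ fun i => measurable_pi_apply (τ i))
    have mUR : Measurable fun q : (Fin (n + 1) → ℝ) × (Fin (n + 1) → Equiv.Perm (Fin C)) =>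
        ((fun i => q.1 (τ i), fun i => q.2 (τ i)) :
          (Fin (n + 1) → ℝ) × (Fin (n + 1) → Equiv.Perm (Fin C))) :=
      (measurable_pi_lambda _ fun i => (measurable_pi_apply (τ i)).comp measurable_fst).prodMk
        (measurable_pi_lambda _ fun i => (measurable_pi_apply (τ i)).comp measurable_snd)
    have i₂ : IndepFun k (fun ω => ((fun i => U (τ i) ω), (fun i => R (τ i) ω))) μ :=
      h₂.comp measurable_id mUR
    have i₁ : IndepFun (fun ω i => Z (τ i) ω)
        (fun ω => (k ω, (fun i => U (τ i) ω), (fun i => R (τ i) ω))) μ :=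
      h₁.comp (measurable_pi_lambda _ fun i => measurable_pi_apply (τ i))
        (measurable_fst.prodMk (mUR.comp measurable_snd))
    rw [(indepFun_iff_map_prod_eq_prod_map_map mZ.aemeasurable
        (hk.prodMk (mU.prodMk mR)).aemeasurable).mp i₁,
      (indepFun_iff_map_prod_eq_prod_map_map hk.aemeasurable (mU.prodMk mR).aemeasurable).mp i₂,
      (indepFun_iff_map_prod_eq_prod_map_map mU.aemeasurable mR.aemeasurable).mp i₃]
  have h1 := key σ
  rw [hZe σ, hUe σ, hRe σ] at h1
  exact h1.trans (key 1).symm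

end Exchange

/-! ### Averaging over rearrangements and return to the prediction set -/

/-- A random element whose law is invariant under rearrangements miscovers with a probability that
is at most a bound on the proportion of rearrangements that miscover. -/
lemma measureReal_miscovers_le {Ω 𝒳 : Type*} [MeasurableSpace Ω] [MeasurableSpace 𝒳]
    {μ : Measure Ω} [IsProbabilityMeasure μ] {C n K : ℕ} {B : Learner 𝒳 C}
    (hB : B.PermInvariant) (hBm : B.JointlyMeasurable) (hn : 0 < n) (hKn : K ∣ n) {α : ℝ}
    (hα : 0 ≤ α) {D : Ω → Sample 𝒳 C n K} (hD : Measurable D)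
    (hsplit : ∀ ω, IsSplit (D ω).2.1)
    (hinv : ∀ σ, μ.map (fun ω => rearrange σ (D ω)) = μ.map D) :
    μ.real {ω | Miscovers B α (D ω)}
      ≤ 2 * α + min (2 * (1 - 1 / (K : ℝ)) / ((n : ℝ) / K + 1))
        ((1 - (K : ℝ) / n) / ((K : ℝ) + 1)) := by
  classical
  have hM := measurableSet_miscovers (n := n) (K := K) hBm α
  have hσD : ∀ σ, Measurable fun ω => rearrange σ (D ω) := fun σ =>
    (measurable_rearrange σ).comp hD
  have hMσ : ∀ σ, MeasurableSet {ω | Miscovers B α (rearrange σ (D ω))} := fun σ => hσD σ hM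
  have heq : ∀ σ, μ.real {ω | Miscovers B α (rearrange σ (D ω))}
      = μ.real {ω | Miscovers B α (D ω)} := fun σ => by
    have h1 := Measure.map_apply (μ := μ) (hσD σ) hM
    have h2 := Measure.map_apply (μ := μ) hD hM
    rw [hinv σ] at h1
    exact congrArg ENNReal.toReal (h1.symm.trans h2)
  have hint : ∀ σ : Equiv.Perm (Fin (n + 1)), Integrable
      ({ω | Miscovers B α (rearrange σ (D ω))}.indicator (1 : Ω → ℝ)) μ := fun σ =>
    (integrable_const (1 : ℝ)).indicator (hMσ σ)
  set β := 2 * α + min (2 * (1 - 1 / (K : ℝ)) / ((n : ℝ) / K + 1))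
        ((1 - (K : ℝ) / n) / ((K : ℝ) + 1)) with hβ
  have hle : ∑ σ : Equiv.Perm (Fin (n + 1)), μ.real {ω | Miscovers B α (rearrange σ (D ω))}
      ≤ β * (n + 1).factorial := by
    calc ∑ σ : Equiv.Perm (Fin (n + 1)), μ.real {ω | Miscovers B α (rearrange σ (D ω))}
        = ∫ ω, ∑ σ : Equiv.Perm (Fin (n + 1)),
            {ω | Miscovers B α (rearrange σ (D ω))}.indicator (1 : Ω → ℝ) ω ∂μ := by
          rw [integral_finsetSum _ fun σ _ => hint σ]
          exact Finset.sum_congr rfl fun σ _ => (integral_indicator_one (hMσ σ)).symm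
      _ ≤ ∫ _, β * (n + 1).factorial ∂μ := by
          refine integral_mono (integrable_finsetSum _ fun σ _ => hint σ) (integrable_const _)
            fun ω => ?_
          refine le_of_eq_of_le ?_ (card_miscovers_rearrange_le hB hn hKn hα (D ω) (hsplit ω))
          refine Finset.sum_congr rfl fun σ _ => ?_
          simp [Set.indicator_apply]
      _ = _ := by simp
  simp only [heq, Finset.sum_const, Finset.card_univ, Fintype.card_perm, Fintype.card_fin,
    nsmul_eq_mul] at hle
  rw [mul_comm] at hle
  exact le_of_mul_le_mul_right hle (by positivity)

lemma mem_cvPlusSet_of_not_miscovers {𝒳 : Type*} {C n K : ℕ} {B : Learner 𝒳 C}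
    (hB : B.Standardized) {α : ℝ} {d : Sample 𝒳 C n K} (hu : ∀ i, d.2.2.1 i ∈ Set.Ioo (0 : ℝ) 1)
    (h : ¬ Miscovers B α d) :
    (d.1 (Fin.last n)).2 ∈ cvPlusSet B α (fun i => d.1 i.castSucc) d.2.1
      (fun i => d.2.2.1 i.castSucc) (fun i => d.2.2.2 i.castSucc) (d.1 (Fin.last n)).1
      (d.2.2.1 (Fin.last n)) (d.2.2.2 (Fin.last n)) := by
  rw [Miscovers, not_le] at h
  refine lt_of_eq_of_lt ?_ h
  refine Finset.sum_congr rfl fun i _ => ?_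
  have hs : ∀ x, (score (foldClassifier B (fun i => d.1 i.castSucc) d.2.1 (d.2.1 i) (d.1 x).1)
      (d.2.2.2 x) (d.1 x).2 (d.2.2.1 x) : ℝ) = foldScore B d i x := fun x =>
    coe_score (hB _ _) _ (hu x)
  have hiff := (Subtype.coe_lt_coe (x :=
    score (foldClassifier B (fun i => d.1 i.castSucc) d.2.1 (d.2.1 i) (d.1 i.castSucc).1)
      (d.2.2.2 i.castSucc) (d.1 i.castSucc).2 (d.2.2.1 i.castSucc)) (y :=
    score (foldClassifier B (fun i => d.1 i.castSucc) d.2.1 (d.2.1 i) (d.1 (Fin.last n)).1)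
      (d.2.2.2 (Fin.last n)) (d.1 (Fin.last n)).2 (d.2.2.1 (Fin.last n)))).symm
  rw [hs, hs] at hiff
  simp only [hiff]

lemma ae_mem_Ioo_of_isUniform {Ω : Type*} [MeasurableSpace Ω] {μ : Measure Ω} {U : Ω → ℝ}
    (hU : Measurable U) (h : pdf.IsUniform U (Set.Ioo 0 1) μ volume) :
    ∀ᵐ ω ∂μ, U ω ∈ Set.Ioo (0 : ℝ) 1 := by
  have h1 : ∀ᵐ x ∂(μ.map U), x ∈ Set.Ioo (0 : ℝ) 1 := by
    rw [show μ.map U = _ from h]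
    exact ae_cond_mem measurableSet_Ioo
  exact ae_of_ae_map hU.aemeasurable h1

end CVPlus

end

theorem theorem2
    {Ω : Type*} [MeasurableSpace Ω] (μ : Measure Ω) [IsProbabilityMeasure μ]
    {𝒳 : Type*} [MeasurableSpace 𝒳]
    (C n K : ℕ) (hn : 0 < n) (hK : K ∣ n)
    (α : ℝ) (hα0 : 0 < α) (hα1 : α < 1)
    -- the learning algorithm
    (B : CVPlus.Learner 𝒳 C) (hB_std : B.Standardized) (hB_meas : B.JointlyMeasurable)
    (hB_perm : B.PermInvariant)
    -- the exchangeable samples; the last one is the test point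
    (X : Fin (n + 1) → Ω → 𝒳) (Y : Fin (n + 1) → Ω → Fin C)
    (hX : ∀ i, Measurable (X i)) (hY : ∀ i, Measurable (Y i))
    (h_exch : CVPlus.Exchangeable (fun i ω => (X i ω, Y i ω)) μ)
    -- the random split into folds
    (k : Ω → Fin n → Fin K) (hk : Measurable k) (hk_split : ∀ ω, CVPlus.IsSplit (k ω))
    -- the uniform variables
    (U : Fin (n + 1) → Ω → ℝ) (hU : ∀ i, Measurable (U i))
    (hU_unif : ∀ i, pdf.IsUniform (U i) (Set.Ioo 0 1) μ volume)
    (hU_indep : iIndepFun U μ)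
    -- the orders that break ties: i.i.d., of any law (a constant order in particular)
    (R : Fin (n + 1) → Ω → Equiv.Perm (Fin C)) (hR : ∀ i, Measurable (R i))
    (hR_ident : ∀ i j, IdentDistrib (R i) (R j) μ μ)
    (hR_indep : iIndepFun R μ)
    -- the samples, the split, the uniform variables and the orders are mutually independent
    (h_indep₁ : IndepFun (fun ω i => (X i ω, Y i ω))
      (fun ω => (k ω, (fun i => U i ω), (fun i => R i ω))) μ)
    (h_indep₂ : IndepFun k (fun ω => ((fun i => U i ω), (fun i => R i ω))) μ)
    (h_indep₃ : IndepFun (fun ω i => U i ω) (fun ω i => R i ω) μ) :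
    1 - 2 * α - min (2 * (1 - 1 / (K : ℝ)) / ((n : ℝ) / K + 1))
        ((1 - (K : ℝ) / n) / ((K : ℝ) + 1))
      ≤ μ.real {ω | Y (Fin.last n) ω ∈
          CVPlus.cvPlusSet B α (fun i : Fin n => (X i.castSucc ω, Y i.castSucc ω)) (k ω)
            (fun i : Fin n => U i.castSucc ω) (fun i : Fin n => R i.castSucc ω)
            (X (Fin.last n) ω) (U (Fin.last n) ω) (R (Fin.last n) ω)} ∧
    (K = n →
      1 - 2 * α
        ≤ μ.real {ω | Y (Fin.last n) ω ∈
            CVPlus.cvPlusSet B α (fun i : Fin n => (X i.castSucc ω, Y i.castSucc ω)) (k ω)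
              (fun i : Fin n => U i.castSucc ω) (fun i : Fin n => R i.castSucc ω)
              (X (Fin.last n) ω) (U (Fin.last n) ω) (R (Fin.last n) ω)}) := by
  have hZ : ∀ i, Measurable fun ω => (X i ω, Y i ω) := fun i => (hX i).prodMk (hY i)
  set D : Ω → CVPlus.Sample 𝒳 C n K :=
    fun ω => (fun i => (X i ω, Y i ω), k ω, fun i => U i ω, fun i => R i ω) with hDdef
  have hD : Measurable D := (measurable_pi_lambda _ hZ).prodMk
    (hk.prodMk ((measurable_pi_lambda _ hU).prodMk (measurable_pi_lambda _ hR)))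
  have hUe : CVPlus.Exchangeable U μ := CVPlus.exchangeable_of_iIndepFun hU hU_indep
    fun i j => (hU_unif i).trans (hU_unif j).symm
  have hRe : CVPlus.Exchangeable R μ := CVPlus.exchangeable_of_iIndepFun hR hR_indep
    fun i j => (hR_ident i j).map_eq
  have hmis := CVPlus.measureReal_miscovers_le hB_perm hB_meas hn hK hα0.le hD hk_split
    (CVPlus.map_rearrange_eq hZ hk hU hR h_exch hUe hRe h_indep₁ h_indep₂ h_indep₃)
  have hM : MeasurableSet {ω | CVPlus.Miscovers B α (D ω)} :=
    hD (CVPlus.measurableSet_miscovers hB_meas α)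
  have hu : ∀ᵐ ω ∂μ, ∀ i, U i ω ∈ Set.Ioo (0 : ℝ) 1 :=
    ae_all_iff.mpr fun i => CVPlus.ae_mem_Ioo_of_isUniform (hU i) (hU_unif i)
  have hcov : μ.real {ω | CVPlus.Miscovers B α (D ω)}ᶜ
      ≤ μ.real {ω | Y (Fin.last n) ω ∈
          CVPlus.cvPlusSet B α (fun i : Fin n => (X i.castSucc ω, Y i.castSucc ω)) (k ω)
            (fun i : Fin n => U i.castSucc ω) (fun i : Fin n => R i.castSucc ω)
            (X (Fin.last n) ω) (U (Fin.last n) ω) (R (Fin.last n) ω)} := by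
    -- An almost sure inclusion suffices, so the coverage event itself need not be shown measurable;
    -- the closed form of the score needs every `U i` in (0, 1).
    refine ENNReal.toReal_mono (measure_ne_top _ _) (measure_mono_ae ?_)
    filter_upwards [hu] with ω hω h
    exact CVPlus.mem_cvPlusSet_of_not_miscovers (d := D ω) hB_std hω h
  rw [probReal_compl_eq_one_sub hM] at hcov
  refine ⟨by linarith, fun hKn => ?_⟩
  have hmin := min_le_right (2 * (1 - 1 / (K : ℝ)) / ((n : ℝ) / K + 1))
    ((1 - (K : ℝ) / n) / ((K : ℝ) + 1))
  -- For folds of size 1 the second term of the minimum vanishes.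
  have hzero : (1 - (K : ℝ) / n) / ((K : ℝ) + 1) = 0 := by
    rw [hKn, div_self (by positivity), sub_self, zero_div]
  linarith
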